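/- Let $r>a\ge 1$ be coprime integers, corresponding to the cyclic group $\frac1r(1,a)=\langle \mathrm{diag}(\varepsilon,\varepsilon^a)\rangle\le \mathrm{GL}(2,\mathbb C)$ with $\varepsilon$ a primitive $r$-th root of unity. Let $$\frac ra=[\alpha_1,\dots,\alpha_n],\qquad \frac r{r-a}=[\beta_1,\dots,\beta_m]$$ be the Hirzebruch--Jung continued fraction expansions, where $[x_1,\dots,x_n]=x_1-\cfrac1{x_2-\cfrac1{\cdots}}$ and all entries are at least $2$. Let $Q$ be the quiver of the reconstruction algebra of $\frac1r(1,a)$: its vertices are $0,1,\dots,n$ (read modulo $n+1$), and its arrows are one clockwise arrow $c_{i,i-1}\colon i\to i-1$ and one anticlockwise arrow $a_{i,i+1}\colon i\to i+1$ for every vertex $i$, and $\alpha_i-2$ extra arrows $i\to 0$ for each $1\le i\le n$. Let $k_1,k_2,\dots$ be the extra arrows, ordered by increasing tail; put $e=3+\sum_i(\alpha_i-2)$, $k_0=c_{1,0}$ and $k_{e-2}=a_{n,0}$, and let $l_h$ be the tail of $k_h$. Let $\mathcal R$ be the coordinate ring of $\mathrm{Rep}(\mathbb CQ,(1,\dots,1))$,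 that is, the polynomial ring over $\mathbb C$ in the arrows of $Q$, with the action of $G=\prod_{q\in Q_0}\mathbb C^*$ given on an arrow $p$ by $\mu\cdot p=\mu_{\mathrm{tail}(p)}^{-1}\,p\,\mu_{\mathrm{head}(p)}$. Put $s_0=s_{m+1}=0$ and $s_t=\beta_t-1$ for $1\le t\le m$. Let $\mathbb C[\mathsf z]$ be the polynomial ring in the variables $z_{i,j}$, $0\le i\le m+1$, $0\le j\le s_i$, and let $\mathrm{QDet}(\mathsf z)$ be the ideal generated by Riemenschneider's quasideterminantal relations $$z_{i,0}\,z_{j+1,s_{j+1}}-z_{i+1,s_{i+1}}\Bigl(\prod_{t=i+1}^{j}\ \prod_{q=1}^{s_t-1}z_{t,q}\Bigr)z_{j,0},\qquad 0\le i<j\le m .$$ Then there is an isomorphism of $\mathbb C$-algebras $$\mathcal R^G\;\cong\;\mathbb C[\mathsf z]/\mathrm{QDet}(\mathsf z),$$ under which the class of $z_{i,j}$ corresponds to the following cycle. Write $C_{0l}$ and $A_{0l}$ for the clockwise and the anticlockwise path from $0$ to $l$, where $C_{00}$ and $A_{00}$ go once around. Then $z_{0,0}\mapsto C_{00}$, $z_{e-1,0}\mapsto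 A_{00}$, and for $1\le i\le e-2$: $z_{i,0}\mapsto C_{0l_i}k_i$, $z_{i,j}\mapsto c_{l_i-j+1,\,l_i-j}\,a_{l_i-j,\,l_i-j+1}$ for $1\le j\le l_i-l_{i-1}$, and $z_{i,\,l_i-l_{i-1}+1}\mapsto A_{0l_{i-1}}k_{i-1}$. (Here $m=e-2$ and $s_i=l_i-l_{i-1}+1$ for $1\le i\le m$.) -/

import Mathlib

namespace Recon

/-! ## Hirzebruch--Jung continued fractions -/

/-- The value of the continued fraction `[x₁, …, xₙ] = x₁ - 1 / (x₂ - 1 / (⋯ - 1 / xₙ))`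
(the value at the empty list is irrelevant). -/
def hjValue : List ℕ → ℚ
  | [] => 0
  | [x] => x
  | x :: y :: l => x - 1 / hjValue (y :: l)

/-- `l` is the Hirzebruch--Jung expansion of `q`: it is non-empty, all its entries are at least `2`,
and its value is `q`. -/
def IsHirzebruchJung (q : ℚ) (l : List ℕ) : Prop :=
  l ≠ [] ∧ (∀ x ∈ l, 2 ≤ x) ∧ hjValue l = q

/-- Every fraction `r / a > 1` has a Hirzebruch--Jung expansion. -/
theorem exists_isHirzebruchJung (a : ℕ) : ∀ r : ℕ, 0 < a → a < r →
    ∃ l, IsHirzebruchJung ((r : ℚ) / a) l := by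
  induction a using Nat.strong_induction_on with
  | _ a ih =>
    intro r ha har
    have hdm := Nat.div_add_mod r a
    have hlt := Nat.mod_lt r ha
    have hq : 1 ≤ r / a := (Nat.one_le_div_iff ha).2 har.le
    have haQ : (a : ℚ) ≠ 0 := by exact_mod_cast ha.ne'
    rcases Nat.eq_zero_or_pos (r % a) with h0 | hpos
    · refine ⟨[r / a], by simp, ?_, ?_⟩
      · intro x hx
        simp only [List.mem_singleton] at hx
        subst hx
        by_contra hcon
        have h1 : r / a = 1 := by omega
        rw [h1] at hdm
        omega
      · have h2 : (r : ℚ) = a * ((r / a : ℕ) : ℚ) := by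
          have h3 : r = a * (r / a) := by omega
          exact_mod_cast h3
        simp only [hjValue]
        rw [h2]
        field_simp
    · obtain ⟨l, hl0, hl2, hlv⟩ := ih (a - r % a) (by omega) a (by omega) (by omega)
      refine ⟨(r / a + 1) :: l, by simp, ?_, ?_⟩
      · intro x hx
        rcases List.mem_cons.1 hx with rfl | hx
        · omega
        · exact hl2 x hx
      · obtain ⟨y, l', rfl⟩ := List.exists_cons_of_ne_nil hl0
        simp only [hjValue]
        rw [hlv, Nat.cast_sub hlt.le]
        rw [one_div_div, Nat.cast_add, Nat.cast_one, eq_div_iff haQ, sub_mul, div_mul_cancel₀ _ haQ]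
        have h2 : (r : ℚ) = a * ((r / a : ℕ) : ℚ) + ((r % a : ℕ) : ℚ) := by
          exact_mod_cast hdm.symm
        linear_combination -h2

/-! ## Representations of a quiver of dimension vector `(1, …, 1)` -/

section Rep

variable (V : Type) [Quiver.{0} V]

/-- The coordinate ring of the affine space of representations of dimension vector `(1, …, 1)`:
the polynomial ring over `ℂ` with one variable for each arrow. -/
abbrev RepRing : Type := MvPolynomial (Quiver.Total V) ℂ

variable {V}

/-- The action of an element `μ` of the torus `∏_{q ∈ Q₀} ℂˣ` on the coordinate ring: the
`ℂ`-algebra map sending an arrow `p` to `μ_{tail p}⁻¹ • p • μ_{head p}`. -/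
noncomputable def torusAct (μ : V → ℂˣ) : RepRing V →ₐ[ℂ] RepRing V :=
  MvPolynomial.aeval fun p =>
    MvPolynomial.C (((μ p.left)⁻¹ * μ p.right : ℂˣ) : ℂ) * MvPolynomial.X p

variable (V)

/-- The ring of invariants of the torus acting on the coordinate ring. -/
noncomputable def invariantRing : Subalgebra ℂ (RepRing V) where
  carrier := {f | ∀ μ : V → ℂˣ, torusAct μ f = f}
  mul_mem' := fun hf hg μ => by rw [map_mul, hf μ, hg μ]
  add_mem' := fun hf hg μ => by rw [map_add, hf μ, hg μ]
  algebraMap_mem' := fun x μ => (torusAct μ).commutes x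

end Rep

/-! ## The quiver of the reconstruction algebra -/

/-- The tails of the extra arrows `k₁, k₂, …`: the list in which the vertices `i = 1, …, n` occur in
increasing order, the vertex `i` exactly `αᵢ - 2` times. -/
def extraTails (α : List ℕ) : List ℕ :=
  (α.zipIdx 1).flatMap fun p => List.replicate (p.1 - 2) p.2

/-- The vertices `0, 1, …, n` of the quiver, where `n` is the length of `α`. -/
def Vertex (α : List ℕ) : Type := Fin (α.length + 1)

/-- The vertex with number `i`, for `0 ≤ i ≤ n`. -/
def vtx (α : List ℕ) (i : ℕ) : Vertex α := Fin.ofNat (α.length + 1) i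

/-- The arrows of the quiver. -/
inductive Arrow (α : List ℕ) : Type
  /-- the clockwise arrow from `i` to `i - 1` (from `0` to `n` if `i = 0`) -/
  | c (i : Fin (α.length + 1)) : Arrow α
  /-- the anticlockwise arrow from `i` to `i + 1` (from `n` to `0` if `i = n`) -/
  | a (i : Fin (α.length + 1)) : Arrow α
  /-- the extra arrow `k_{h+1}` -/
  | k (h : Fin (extraTails α).length) : Arrow α

/-- The tail of an arrow. Addition and subtraction in `Fin (n + 1)` are modulo `n + 1`. -/
def Arrow.tail {α : List ℕ} : Arrow α → Vertex α
  | .c i => i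
  | .a i => i
  | .k h => vtx α ((extraTails α).get h)

/-- The head of an arrow. -/
def Arrow.head {α : List ℕ} : Arrow α → Vertex α
  | .c i => i - (1 : Fin (α.length + 1))
  | .a i => i + (1 : Fin (α.length + 1))
  | .k _ => vtx α 0

/-- The quiver of the reconstruction algebra attached to the labels `α = [α₁, …, αₙ]`: the double
of the extended Dynkin quiver of type `Aₙ`, with `αᵢ - 2` extra arrows from the vertex `i` to the
vertex `0` for each `i = 1, …, n`. -/
instance reconQuiver (α : List ℕ) : Quiver.{0} (Vertex α) where
  Hom x y := {p : Arrow α // p.tail = x ∧ p.head = y}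

/-- The variable of the coordinate ring that belongs to an arrow. -/
noncomputable def arrowVar {α : List ℕ} (p : Arrow α) : RepRing (Vertex α) :=
  MvPolynomial.X ⟨p.tail, p.head, ⟨p, rfl, rfl⟩⟩

/-! ## The generating cycles -/

section Cycles

variable (α : List ℕ)

/-- The clockwise arrow from the vertex `i` to the vertex `i - 1` (to `n`, if `i = 0`). -/
noncomputable def cVar (i : ℕ) : RepRing (Vertex α) :=
  arrowVar (.c (Fin.ofNat (α.length + 1) i))

/-- The anticlockwise arrow from the vertex `i` to the vertex `i + 1` (to `0`, if `i = n`). -/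
noncomputable def aVar (i : ℕ) : RepRing (Vertex α) :=
  arrowVar (.a (Fin.ofNat (α.length + 1) i))

/-- The arrow `k_h` for `0 ≤ h ≤ 1 + ∑ (αᵢ - 2)`: by convention `k₀` is the clockwise arrow from `1`
to `0`, and the last one is the anticlockwise arrow from `n` to `0`. -/
noncomputable def kVar (h : ℕ) : RepRing (Vertex α) :=
  if h = 0 then cVar α 1
  else if hk : h - 1 < (extraTails α).length then arrowVar (.k ⟨h - 1, hk⟩)
  else aVar α α.length

/-- The number `l_h` of the tail of `k_h`, for `0 ≤ h ≤ 1 + ∑ (αᵢ - 2)`. -/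
def l (h : ℕ) : ℕ := (1 :: extraTails α ++ [α.length]).getD h 0

/-- The clockwise path `C_{0l}` from `0` to `l`, for `0 ≤ l ≤ n`; by convention `C_{00}` goes once
around. -/
noncomputable def CPath (l : ℕ) : RepRing (Vertex α) :=
  cVar α 0 * ∏ i ∈ Finset.Ioc l α.length, cVar α i

/-- The anticlockwise path `A_{0l}` from `0` to `l`, for `0 ≤ l ≤ n`; by convention `A_{00}` goes
once around. -/
noncomputable def APath (l : ℕ) : RepRing (Vertex α) :=
  if l = 0 then ∏ i ∈ Finset.range (α.length + 1), aVar α i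
  else ∏ i ∈ Finset.range l, aVar α i

/-- The cycle `z_{i,j}`. The embedding dimension is `e = 3 + ∑ (αᵢ - 2)`. -/
noncomputable def cycle (i j : ℕ) : RepRing (Vertex α) :=
  if i = 0 then CPath α 0
  else if i ≤ (extraTails α).length + 1 then
    if j = 0 then CPath α (l α i) * kVar α i
    else if j ≤ l α i - l α (i - 1) then cVar α (l α i - (j - 1)) * aVar α (l α i - j)
    else APath α (l α (i - 1)) * kVar α (i - 1)
  else APath α 0

end Cycles

/-! ## Quasideterminantal relations -/

/-- A `2 × (N + 1)` quasimatrix: a top row, a bottom row, and `N` middle entries, the `t`-th one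
between the columns `t` and `t + 1`. -/
structure QuasiMatrix (R : Type) (N : ℕ) where
  top : Fin (N + 1) → R
  mid : Fin N → R
  bot : Fin (N + 1) → R

/-- The set of the quasiminors `aᵢ bⱼ - bᵢ (Wᵢ ⋯ W_{j-1}) aⱼ`, `i < j`, of a quasimatrix. -/
def QuasiMatrix.quasiminors {R : Type} [CommRing R] {N : ℕ} (X : QuasiMatrix R N) : Set R :=
  {f | ∃ i j : Fin (N + 1), i < j ∧
    f = X.top i * X.bot j -
      X.bot i * (∏ t ∈ Finset.univ.filter (fun t : Fin N => (i : ℕ) ≤ t ∧ (t : ℕ) < j), X.mid t) * X.top j}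

section QDet

variable (β : List ℕ)

/-- `s_t = β_t - 1` for `1 ≤ t ≤ m`, where `m` is the length of `β`, and `s_0 = s_{m+1} = 0`. -/
def s (t : ℕ) : ℕ := if 1 ≤ t ∧ t ≤ β.length then β.getD (t - 1) 0 - 1 else 0

/-- The index set of the variables `z_{i,j}`, `0 ≤ i ≤ m + 1`, `0 ≤ j ≤ s_i`. -/
abbrev ZIndex : Type := Σ i : Fin (β.length + 2), Fin (s β i + 1)

/-- The polynomial ring `ℂ[z]`. -/
abbrev ZRing : Type := MvPolynomial (ZIndex β) ℂ

/-- The quasimatrix with top row `z_{0,0}, …, z_{m,0}`, bottom row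
`z_{1,s_1}, …, z_{m+1,s_{m+1}}`, and middle entries `z_{t,s_t-1} ⋯ z_{t,1}` for `t = 1, …, m`. -/
noncomputable def zMatrix : QuasiMatrix (ZRing β) β.length where
  top i := MvPolynomial.X ⟨i.castSucc, 0⟩
  mid t := ∏ j ∈ Finset.univ.filter
      (fun j : Fin (s β (t.succ.castSucc : Fin (β.length + 2)) + 1) =>
        0 < (j : ℕ) ∧ (j : ℕ) < s β (t.succ.castSucc : Fin (β.length + 2))),
    MvPolynomial.X ⟨t.succ.castSucc, j⟩
  bot i := MvPolynomial.X ⟨i.succ, Fin.last _⟩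

/-- The ideal of `ℂ[z]` generated by the set of quasideterminantal relations. -/
noncomputable def QDet : Ideal (ZRing β) := Ideal.span (zMatrix β).quasiminors

end QDet

end Recon

/-! ### Hirzebruch--Jung expansions and Riemenschneider duality. -/

namespace Recon

/-! Three facts combine. First, Riemenschneider duality (`hjValue_gaps`, `IsHirzebruchJung.dual`):
the dual expansion satisfies `β_t = l_t - l_{t-1} + 2`, so the shape of the quasimatrix is dictated
by the tails `l_h` of the arrows `k_h`.

Secondly, everything is monomial. Splitting the quiver at the vertex `0` leaves a double path `1, …,
n` with arrows `c0`, `a0` entering its ends and return arrows `k_h`. Each `k_h` gives a column, with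
top entry `C_{0l_h} k_h` and bottom entry `A_{0l_h} k_h`. Each gap between adjacent vertices of the
path gives a 2-cycle `c a`. Only one combinatorial datum remains: the relation `B i t`, meaning that
column `i` returns from below the gap `t`. For each `t` these columns form an initial segment
(hypothesis `hB`).

The kernel of the monomial map is found by straightening (`ker_genMap`). For `i < j` a quasiminor
trades `top i * bot j` for `bot i * gaps * top j`, and repeated trades end in a straight monomial
(`exists_isStraight`). A straight monomial is recovered from its image (`IsStraight.ext`), so
monomials with equal image are congruent modulo the quasiminors.

Thirdly, the torus acts diagonally on monomials, so an invariant is a combination of monomials that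
conserve flow at every vertex (`sum_head_eq_sum_tail`). Summing the conservation laws over `1, …, u`
gives the cut equations `IsBalanced`. An exponent satisfying them is a sum of exponents of
generators (`IsBalanced.exists_monoExp`): the units of flow on `a0` are assigned greedily to the
leftmost columns. Hence the image is the whole ring of invariants, and relabelling (`arrEquiv`,
`genEquiv`) carries this to the quiver and to `ZRing β`. -/

theorem hjValue_cons (x : ℕ) {l : List ℕ} (hl : l ≠ []) :
    hjValue (x :: l) = x - 1 / hjValue l := by
  obtain ⟨y, l', rfl⟩ := List.exists_cons_of_ne_nil hl
  rfl

theorem one_lt_hjValue {l : List ℕ} (hl : l ≠ []) (h : ∀ x ∈ l, 2 ≤ x) : 1 < hjValue l := by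
  induction l with
  | nil => exact absurd rfl hl
  | cons x l ih =>
    have hx : (2 : ℚ) ≤ x := by exact_mod_cast h x (by simp)
    rcases eq_or_ne l [] with rfl | hl'
    · simp only [hjValue]; linarith
    · have := ih hl' fun y hy => h y (by simp [hy])
      rw [hjValue_cons x hl']
      have h1 : 1 / hjValue l < 1 := by rw [div_lt_one (by linarith)]; exact this
      linarith

/-- The tail subtracts a number in `[0, 1)`, so the first entry can be read off the value; this
drives uniqueness of expansions. -/
theorem ceil_hjValue_cons {x : ℕ} {l : List ℕ} (h : ∀ y ∈ l, 2 ≤ y) :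
    ⌈hjValue (x :: l)⌉ = (x : ℤ) := by
  rcases eq_or_ne l [] with rfl | hl'
  · simp [hjValue]
  · have := one_lt_hjValue hl' h
    have h1 : 1 / hjValue l < 1 := by rw [div_lt_one (by linarith)]; exact this
    have h2 : 0 < 1 / hjValue l := by positivity
    rw [hjValue_cons x hl', Int.ceil_eq_iff]
    push_cast
    constructor <;> linarith

/-- Hirzebruch--Jung expansions are unique. -/
theorem hjValue_injective {l l' : List ℕ} (hl : l ≠ []) (hl' : l' ≠ [])
    (h : ∀ x ∈ l, 2 ≤ x) (h' : ∀ x ∈ l', 2 ≤ x) (heq : hjValue l = hjValue l') : l = l' := by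
  induction l generalizing l' with
  | nil => exact absurd rfl hl
  | cons x l ih =>
    obtain ⟨y, l', rfl⟩ := List.exists_cons_of_ne_nil hl'
    have hl2 : ∀ z ∈ l, 2 ≤ z := fun z hz => h z (by simp [hz])
    have hl2' : ∀ z ∈ l', 2 ≤ z := fun z hz => h' z (by simp [hz])
    have hxy : x = y := by
      have h1 := ceil_hjValue_cons (x := x) hl2
      rw [heq, ceil_hjValue_cons hl2'] at h1
      exact_mod_cast h1.symm
    subst hxy
    congr 1
    rcases eq_or_ne l [] with rfl | hn <;> rcases eq_or_ne l' [] with rfl | hn'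
    · rfl
    · have := one_lt_hjValue hn' hl2'
      have h2 : 0 < 1 / hjValue l' := by positivity
      rw [hjValue_cons x hn'] at heq
      simp only [hjValue] at heq
      linarith
    · have := one_lt_hjValue hn hl2
      have h2 : 0 < 1 / hjValue l := by positivity
      rw [hjValue_cons x hn] at heq
      simp only [hjValue] at heq
      linarith
    · have h1 := one_lt_hjValue hn hl2
      have h2 := one_lt_hjValue hn' hl2'
      rw [hjValue_cons x hn, hjValue_cons x hn'] at heq
      refine ih hn hn' hl2 hl2' ?_
      simpa using heq

/-- The list of the numbers `x_t - x_{t-1} + 2`, where `x_0 = p`. -/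
def gaps : ℕ → List ℕ → List ℕ
  | _, [] => []
  | p, x :: L => (x - p + 2) :: gaps x L

theorem two_le_of_mem_gaps {p : ℕ} {L : List ℕ} : ∀ x ∈ gaps p L, 2 ≤ x := by
  induction L generalizing p with
  | nil => simp [gaps]
  | cons y L ih =>
    intro x hx
    rcases List.mem_cons.1 hx with rfl | hx
    · omega
    · exact ih x hx

theorem gaps_map_succ (p : ℕ) (L : List ℕ) : gaps (p + 1) (L.map (· + 1)) = gaps p L := by
  induction L generalizing p with
  | nil => rfl
  | cons y L ih => simp [gaps, ih]

theorem length_gaps (p : ℕ) (L : List ℕ) : (gaps p L).length = L.length := by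
  induction L generalizing p with
  | nil => rfl
  | cons y L ih => simp [gaps, ih]

theorem getD_gaps (p : ℕ) (L : List ℕ) (t : ℕ) (ht : t < L.length) :
    (gaps p L).getD t 0 = (p :: L).getD (t + 1) 0 - (p :: L).getD t 0 + 2 := by
  induction L generalizing p t with
  | nil => simp at ht
  | cons y L ih =>
    cases t with
    | zero => simp [gaps]
    | succ t =>
      have := ih y t (by simpa using ht)
      simpa [gaps] using this

/-- The list `extraTails`, for vertices numbered from `k` on. -/
def tailsFrom (k : ℕ) (α : List ℕ) : List ℕ :=
  (α.zipIdx k).flatMap fun p => List.replicate (p.1 - 2) p.2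

theorem tailsFrom_cons (k x : ℕ) (α : List ℕ) :
    tailsFrom k (x :: α) = List.replicate (x - 2) k ++ tailsFrom (k + 1) α := by
  simp [tailsFrom, List.zipIdx_cons]

theorem tailsFrom_succ (k : ℕ) (α : List ℕ) :
    tailsFrom (k + 1) α = (tailsFrom k α).map (· + 1) := by
  induction α generalizing k with
  | nil => rfl
  | cons x α ih => simp [tailsFrom_cons, ih]

theorem mem_tailsFrom {k : ℕ} {α : List ℕ} : ∀ x ∈ tailsFrom k α, k ≤ x ∧ x < k + α.length := by
  induction α generalizing k with
  | nil => simp [tailsFrom]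
  | cons y α ih =>
    intro x hx
    rw [tailsFrom_cons, List.mem_append] at hx
    rcases hx with hx | hx
    · have := List.eq_of_mem_replicate hx
      simp; omega
    · have := ih x hx
      simp; omega

theorem sorted_tailsFrom (k : ℕ) (α : List ℕ) : (tailsFrom k α).Pairwise (· ≤ ·) := by
  induction α generalizing k with
  | nil => simp [tailsFrom]
  | cons y α ih =>
    rw [tailsFrom_cons, List.pairwise_append]
    refine ⟨by simp [List.pairwise_replicate], ih _, ?_⟩
    intro a ha b hb
    have := List.eq_of_mem_replicate ha
    have := mem_tailsFrom b hb
    omega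

/-- Riemenschneider's duality: the dual continued fraction is read off the vertices of the extra
arrows. -/
theorem hjValue_gaps {α : List ℕ} (hα : α ≠ []) (h : ∀ x ∈ α, 2 ≤ x) :
    hjValue (gaps 1 (tailsFrom 1 α ++ [α.length])) = hjValue α / (hjValue α - 1) := by
  induction α with
  | nil => exact absurd rfl hα
  | cons x α ih =>
    obtain ⟨y, rfl⟩ : ∃ y, x = y + 2 := ⟨x - 2, by have := h x (by simp); omega⟩
    have hα2 : ∀ z ∈ α, 2 ≤ z := fun z hz => h z (by simp [hz])
    clear h
    induction y with
    | zero =>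
      rcases eq_or_ne α [] with rfl | hn
      · norm_num [tailsFrom, gaps, hjValue]
      · have ih := ih hn hα2
        have h1 := one_lt_hjValue hn hα2
        have hq : hjValue α - 1 ≠ 0 := by linarith
        have hq0 : hjValue α ≠ 0 := by linarith
        -- Prepending a `2` creates no extra arrow and only shifts the tails by one, so just the
        -- first gap grows, by `1`. On values: `q ↦ 2 - 1/q` adds `1` to `q/(q-1)`.
        have key : hjValue ((0 + 2) :: α) / (hjValue ((0 + 2) :: α) - 1) =
            hjValue α / (hjValue α - 1) + 1 := by
          rw [hjValue_cons _ hn]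
          have : ((0 + 2 : ℕ) : ℚ) - 1 / hjValue α - 1 = (hjValue α - 1) / hjValue α := by
            push_cast; field_simp; ring
          rw [this]; push_cast; field_simp; ring
        rw [key, ← ih, tailsFrom_cons, tailsFrom_succ]
        have hM : (List.replicate (0 + 2 - 2) 1 ++ (tailsFrom 1 α).map (· + 1)) ++
            [((0 + 2) :: α).length] = (tailsFrom 1 α ++ [α.length]).map (· + 1) := by simp
        rw [hM]
        obtain ⟨z, L, hL⟩ := List.exists_cons_of_ne_nil
          (l := tailsFrom 1 α ++ [α.length]) (by simp)
        -- Needed because the gaps are truncated differences.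
        have hz : 1 ≤ z := by
          have hz : z ∈ tailsFrom 1 α ++ [α.length] := by rw [hL]; simp
          rcases List.mem_append.1 hz with hz | hz
          · exact (mem_tailsFrom z hz).1
          · have := List.length_pos_of_ne_nil hn
            simp at hz; omega
        rw [hL]
        simp only [List.map_cons, gaps, gaps_map_succ]
        have e1 : z + 1 - 1 + 2 = (z - 1 + 2) + 1 := by omega
        rw [e1]
        rcases eq_or_ne (gaps z L) [] with hg | hg
        · rw [hg]; simp [hjValue]
        · rw [hjValue_cons _ hg, hjValue_cons _ hg]; push_cast; ring
    | succ y ihy =>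
      have hc : ∀ z ∈ (y + 2) :: α, 2 ≤ z := by
        intro z hz
        rcases List.mem_cons.1 hz with rfl | hz
        · omega
        · exact hα2 z hz
      have h1 := one_lt_hjValue (by simp) hc
      have h2 : hjValue ((y + 1 + 2) :: α) = hjValue ((y + 2) :: α) + 1 := by
        rcases eq_or_ne α [] with rfl | hn
        · simp [hjValue]; ring
        · rw [hjValue_cons _ hn, hjValue_cons _ hn]; push_cast; ring
      -- Raising the first entry by `1` adds an arrow with tail `1`, hence a new leading gap `1 - 1
      -- + 2 = 2`. This matches `(q+1)/q = 2 - (q-1)/q`.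
      have h3 : tailsFrom 1 ((y + 1 + 2) :: α) ++ [((y + 1 + 2) :: α).length] =
          1 :: (tailsFrom 1 ((y + 2) :: α) ++ [((y + 2) :: α).length]) := by
        simp [tailsFrom_cons, List.replicate_succ]
      rw [h3, gaps, hjValue_cons _ (by
        rw [← List.length_pos_iff, length_gaps]; simp), ihy (by simp), h2]
      have hq : hjValue ((y + 2) :: α) - 1 ≠ 0 := by linarith
      have hq0 : hjValue ((y + 2) :: α) ≠ 0 := by linarith
      push_cast
      field_simp
      simp
      field_simp
      ring

theorem extraTails_eq (α : List ℕ) : extraTails α = tailsFrom 1 α := rfl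

/-- The dual Hirzebruch--Jung expansion. -/
theorem IsHirzebruchJung.dual {q : ℚ} {α β : List ℕ} (hα : IsHirzebruchJung q α)
    (hβ : IsHirzebruchJung (q / (q - 1)) β) : β = gaps 1 (extraTails α ++ [α.length]) := by
  refine hjValue_injective hβ.1 ?_ hβ.2.1 two_le_of_mem_gaps ?_
  · rw [← List.length_pos_iff, length_gaps]; simp
  · rw [hβ.2.2, extraTails_eq, hjValue_gaps hα.1 hα.2.1, hα.2.2]

end Recon

/-! ### The monomial model: straightening and balanced exponents. -/

namespace Recon
open MvPolynomial

set_option linter.unusedSectionVars false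

/-- The variables of a quasimatrix with columns `I` whose middle entries are products of variables
indexed by `Γ`. -/
inductive Gen (I Γ : Type) : Type
  | top (i : I)
  | bot (i : I)
  | gap (t : Γ)

/-- The arrows of a double path with return arrows `κ i`: arrows `c0`, `a0` to the two ends, and
for each gap `t` a pair of opposite arrows. -/
inductive Arr (I Γ : Type) : Type
  | c0
  | a0
  | κ (i : I)
  | c (t : Γ)
  | a (t : Γ)

section

variable {I Γ : Type} [Fintype I] [LinearOrder I] [Fintype Γ] [DecidableEq Γ]
  (B : I → Γ → Prop) [∀ i t, Decidable (B i t)]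

/-- The exponent of the cycle belonging to a generator, where `B i t` says that the column `i` lies
below the gap `t`. -/
noncomputable def genExp : Gen I Γ → Arr I Γ →₀ ℕ
  | .top i => .single .c0 1 + .single (.κ i) 1 + ∑ t with B i t, .single (.c t) 1
  | .bot i => .single .a0 1 + .single (.κ i) 1 + ∑ t with ¬ B i t, .single (.a t) 1
  | .gap t => .single (.c t) 1 + .single (.a t) 1

/-- The exponent of the image of a monomial. -/
noncomputable def monoExp : (Gen I Γ →₀ ℕ) →+ (Arr I Γ →₀ ℕ) :=
  Finsupp.liftAddHom fun g => (multiplesHom (Arr I Γ →₀ ℕ)) (genExp B g)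

/-- The algebra map sending each generator to its cycle. -/
noncomputable def genMap : MvPolynomial (Gen I Γ) ℂ →ₐ[ℂ] MvPolynomial (Arr I Γ) ℂ :=
  aeval fun g => monomial (genExp B g) 1

theorem monoExp_single (g : Gen I Γ) (k : ℕ) : monoExp B (.single g k) = k • genExp B g := by
  simp [monoExp]

theorem genMap_monomial (e : Gen I Γ →₀ ℕ) (z : ℂ) :
    genMap B (monomial e z) = monomial (monoExp B e) z := by
  rw [genMap, aeval_monomial, monoExp, Finsupp.liftAddHom_apply]
  simp only [monomial_pow, one_pow]
  rw [Finsupp.prod, ← monomial_sum_one, algebraMap_eq, C_mul_monomial, mul_one, Finsupp.sum]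
  rfl

theorem sum_gen (F : Gen I Γ → ℕ) [Fintype (Gen I Γ)] :
    ∑ g, F g = ∑ i, F (.top i) + ∑ i, F (.bot i) + ∑ t, F (.gap t) := by
  let e : I ⊕ I ⊕ Γ ≃ Gen I Γ :=
    { toFun := Sum.elim .top (Sum.elim .bot .gap)
      invFun := fun g => match g with
        | .top i => .inl i
        | .bot i => .inr (.inl i)
        | .gap t => .inr (.inr t)
      left_inv := by rintro (i | i | t) <;> rfl
      right_inv := by rintro (i | i | t) <;> rfl }
  rw [← e.sum_comp]
  simp [e, add_assoc]

noncomputable instance : Fintype (Gen I Γ) := by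
  classical exact Fintype.ofSurjective (Sum.elim Gen.top (Sum.elim Gen.bot Gen.gap)) (by
    rintro (i | i | t)
    exacts [⟨.inl i, rfl⟩, ⟨.inr (.inl i), rfl⟩, ⟨.inr (.inr t), rfl⟩])

theorem monoExp_apply (e : Gen I Γ →₀ ℕ) (p : Arr I Γ) :
    monoExp B e p = ∑ i, e (.top i) * genExp B (.top i) p + ∑ i, e (.bot i) * genExp B (.bot i) p +
      ∑ t, e (.gap t) * genExp B (.gap t) p := by
  rw [monoExp, Finsupp.liftAddHom_apply, Finsupp.sum_fintype _ _ (by simp), Finsupp.finsetSum_apply,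
    sum_gen]
  simp

theorem monoExp_c0 (e : Gen I Γ →₀ ℕ) : monoExp B e .c0 = ∑ i, e (.top i) := by
  classical
  simp only [monoExp_apply, genExp, Finsupp.add_apply, Finsupp.finsetSum_apply, Finsupp.single_apply]
  simp

theorem monoExp_a0 (e : Gen I Γ →₀ ℕ) : monoExp B e .a0 = ∑ i, e (.bot i) := by
  classical
  simp only [monoExp_apply, genExp, Finsupp.add_apply, Finsupp.finsetSum_apply, Finsupp.single_apply]
  simp

theorem monoExp_κ (e : Gen I Γ →₀ ℕ) (i : I) :
    monoExp B e (.κ i) = e (.top i) + e (.bot i) := by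
  classical
  simp only [monoExp_apply, genExp, Finsupp.add_apply, Finsupp.finsetSum_apply, Finsupp.single_apply]
  simp

theorem monoExp_c (e : Gen I Γ →₀ ℕ) (t : Γ) :
    monoExp B e (.c t) = (∑ i with B i t, e (.top i)) + e (.gap t) := by
  classical
  simp only [monoExp_apply, genExp, Finsupp.add_apply, Finsupp.finsetSum_apply, Finsupp.single_apply]
  simp [Finset.sum_filter]

theorem monoExp_a (e : Gen I Γ →₀ ℕ) (t : Γ) :
    monoExp B e (.a t) = (∑ i with ¬ B i t, e (.bot i)) + e (.gap t) := by
  classical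
  simp only [monoExp_apply, genExp, Finsupp.add_apply, Finsupp.finsetSum_apply, Finsupp.single_apply]
  simp [Finset.sum_filter]

/-- The quasideterminantal relation of the columns `i` and `j`. -/
noncomputable def qrel (i j : I) : MvPolynomial (Gen I Γ) ℂ :=
  X (.top i) * X (.bot j) - X (.bot i) * (∏ t with B i t ∧ ¬ B j t, X (.gap t)) * X (.top j)

/-- The ideal of the quasideterminantal relations. -/
noncomputable def qideal : Ideal (MvPolynomial (Gen I Γ) ℂ) :=
  Ideal.span {f | ∃ i j, i < j ∧ f = qrel B i j}

/-- The exponent of the second term of a quasideterminantal relation. -/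
noncomputable def swapExp (i j : I) : Gen I Γ →₀ ℕ :=
  .single (.bot i) 1 + (∑ t with B i t ∧ ¬ B j t, .single (.gap t) 1) + .single (.top j) 1

theorem qrel_eq (i j : I) : qrel B i j =
    monomial (Finsupp.single (Gen.top i) 1 + .single (.bot j) 1) 1 - monomial (swapExp B i j) 1 := by
  rw [qrel, swapExp]
  simp only [X, monomial_mul, ← monomial_sum_one, mul_one]

variable (hB : ∀ i j t, i ≤ j → B j t → B i t)

include hB in
-- The clockwise path of column `i` exceeds that of column `j` exactly by the gaps that separate
-- them, and likewise the anticlockwise path of `j` exceeds that of `i`. The 2-cycles at these gaps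
-- make up both differences.
theorem monoExp_swapExp {i j : I} (hij : i < j) :
    monoExp B (swapExp B i j) = monoExp B (Finsupp.single (Gen.top i) 1 + .single (.bot j) 1) := by
  have h1 : ∑ t with B i t, (Finsupp.single (Arr.c t) 1 : Arr I Γ →₀ ℕ) =
      ∑ t with B i t ∧ ¬ B j t, .single (Arr.c t) 1 + ∑ t with B j t, .single (Arr.c t) 1 := by
    rw [← Finset.sum_filter_add_sum_filter_not (Finset.univ.filter (B i)) (fun t => ¬ B j t),
      Finset.filter_filter, Finset.filter_filter]
    congr 2
    ext t
    have := hB i j t hij.le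
    simp; tauto
  have h2 : ∑ t with ¬ B j t, (Finsupp.single (Arr.a t) 1 : Arr I Γ →₀ ℕ) =
      ∑ t with B i t ∧ ¬ B j t, .single (Arr.a t) 1 + ∑ t with ¬ B i t, .single (Arr.a t) 1 := by
    rw [← Finset.sum_filter_add_sum_filter_not (Finset.univ.filter (fun t => ¬ B j t)) (fun t => B i t),
      Finset.filter_filter, Finset.filter_filter]
    congr 2
    · ext t; simp; tauto
    · ext t
      have := hB i j t hij.le
      simp; tauto
  simp only [swapExp, map_add, map_sum, monoExp_single, one_smul, genExp]
  rw [h1, h2, Finset.sum_add_distrib]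
  abel

include hB in
theorem qideal_le_ker : qideal B ≤ RingHom.ker (genMap B) := by
  rw [qideal, Ideal.span_le]
  rintro f ⟨i, j, hij, rfl⟩
  rw [SetLike.mem_coe, RingHom.mem_ker, qrel_eq, map_sub, genMap_monomial, genMap_monomial,
    monoExp_swapExp B hB hij, sub_self]

/-- A monomial is straight if it is not divisible by the first term of a quasideterminantal
relation. -/
def IsStraight (e : Gen I Γ →₀ ℕ) : Prop :=
  ∀ i j, i < j → e (.top i) = 0 ∨ e (.bot j) = 0

/-- A weight that decreases when the first term of a quasideterminantal relation is replaced by the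
second one. -/
noncomputable def botWeight : (Gen I Γ →₀ ℕ) →+ ℕ :=
  Finsupp.weight fun g => match g with
    | .bot j => (Finset.univ.filter (· < j)).card
    | _ => 0

include hB in
-- Straightening: as long as some `top i * bot j` with `i < j` divides the monomial, a quasiminor
-- replaces it, and `botWeight` forces termination.
theorem exists_isStraight (e : Gen I Γ →₀ ℕ) : ∃ e', IsStraight e' ∧ monoExp B e' = monoExp B e ∧
    (monomial e 1 - monomial e' 1 : MvPolynomial (Gen I Γ) ℂ) ∈ qideal B := by
  induction hN : botWeight e using Nat.strong_induction_on generalizing e with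
  | _ N ih =>
    by_cases hs : IsStraight e
    · exact ⟨e, hs, rfl, by simp⟩
    simp only [IsStraight] at hs
    push Not at hs
    obtain ⟨i, j, hij, hi, hj⟩ := hs
    set d : Gen I Γ →₀ ℕ := .single (.top i) 1 + .single (.bot j) 1 with hd
    have hle : d ≤ e := by
      classical
      intro g
      rw [hd, Finsupp.add_apply, Finsupp.single_apply, Finsupp.single_apply]
      cases g <;> simp <;> split_ifs <;> subst_vars <;> omega
    obtain ⟨e₀, rfl⟩ : ∃ e₀, e = e₀ + d := ⟨e - d, (tsub_add_cancel_of_le hle).symm⟩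
    -- The weights are the numbers of columns before `i` and before `j`; the column `i` itself makes
    -- the inequality strict.
    have hw : botWeight (swapExp B i j) < botWeight d := by
      simp only [swapExp, hd, map_add, map_sum, botWeight, Finsupp.weight_single]
      simp only [smul_zero, zero_add, add_zero, Finset.sum_const_zero, one_smul]
      refine Finset.card_lt_card ⟨fun k hk => ?_, fun h => ?_⟩
      · simp only [Finset.mem_filter, Finset.mem_univ, true_and] at hk ⊢
        exact hk.trans hij
      · simpa using h (show i ∈ _ by simpa using hij)
    obtain ⟨e', hs, he, hm⟩ := ih (botWeight (e₀ + swapExp B i j))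
      (by rw [← hN, map_add, map_add]; omega) _ rfl
    refine ⟨e', hs, ?_, ?_⟩
    · rw [he, map_add, map_add, monoExp_swapExp B hB hij]
    · have h1 : (monomial (e₀ + d) 1 - monomial (e₀ + swapExp B i j) 1 :
          MvPolynomial (Gen I Γ) ℂ) = monomial e₀ 1 * qrel B i j := by
        rw [qrel_eq, mul_sub, monomial_mul, monomial_mul, mul_one]
      have h2 := Ideal.mul_mem_left (qideal B) (monomial e₀ 1)
        (Ideal.subset_span ⟨i, j, hij, rfl⟩ : qrel B i j ∈ qideal B)
      rw [← h1] at h2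
      simpa using add_mem h2 hm

/-- A straight monomial is determined by its image. -/
theorem IsStraight.ext {e e' : Gen I Γ →₀ ℕ} (h : IsStraight e) (h' : IsStraight e')
    (hee : monoExp B e = monoExp B e') : e = e' := by
  have hk : ∀ i, e (.top i) + e (.bot i) = e' (.top i) + e' (.bot i) := fun i => by
    rw [← monoExp_κ B, ← monoExp_κ B, hee]
  have hsum : ∑ i, e (.bot i) = ∑ i, e' (.bot i) := by
    rw [← monoExp_a0 B, ← monoExp_a0 B, hee]
  have hbot : ∀ i, e (.bot i) = e' (.bot i) := by
    by_contra! hne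
    obtain ⟨i, hi⟩ := hne
    have aux : ∀ {u v : I → ℕ}, ∑ i, u i = ∑ i, v i → ∀ i, u i < v i → ∃ j, v j < u j := by
      intro u v huv i hi
      by_contra! hcon
      exact (Finset.sum_lt_sum (fun j _ => hcon j) ⟨i, Finset.mem_univ i, hi⟩).ne huv
    -- Equal totals force the bottom exponents to differ in both directions. Straightness of `e` or
    -- of `e'`, according to the order of the two columns, then contradicts the equal column sums
    -- `hk`.
    obtain ⟨i, j, hi, hj⟩ : ∃ i j, e (.bot i) < e' (.bot i) ∧ e' (.bot j) < e (.bot j) := by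
      rcases lt_or_gt_of_ne hi with hi | hi
      · exact ⟨i, (aux hsum i hi).imp fun j hj => ⟨hi, hj⟩⟩
      · obtain ⟨j, hj⟩ := aux hsum.symm i hi
        exact ⟨j, i, hj, hi⟩
    have h1 := hk i
    have h2 := hk j
    rcases lt_trichotomy i j with hij | rfl | hij
    · rcases h i j hij with h | h <;> omega
    · omega
    · rcases h' j i hij with h | h <;> omega
  have htop : ∀ i, e (.top i) = e' (.top i) := fun i => by
    have := hk i
    have := hbot i
    omega
  ext g
  rcases g with i | i | t
  · exact htop i
  · exact hbot i
  · have := DFunLike.congr_fun hee (.c t)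
    rw [monoExp_c, monoExp_c] at this
    simp only [htop] at this
    omega

include hB in
theorem ker_genMap : RingHom.ker (genMap B) = qideal B := by
  refine le_antisymm (fun f hf => ?_) (qideal_le_ker B hB)
  classical
  have hcongr : ∀ e e', monoExp B e = monoExp B e' →
      (monomial e 1 - monomial e' 1 : MvPolynomial (Gen I Γ) ℂ) ∈ qideal B := by
    intro e e' hee
    obtain ⟨d, hd, hde, hm⟩ := exists_isStraight B hB e
    obtain ⟨d', hd', hde', hm'⟩ := exists_isStraight B hB e'
    obtain rfl := hd.ext B hd' (by rw [hde, hde', hee])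
    simpa using sub_mem hm hm'
  let q : MvPolynomial (Gen I Γ) ℂ →ₐ[ℂ] _ := Ideal.Quotient.mkₐ ℂ (qideal B)
  -- A linear map with `ρ ∘ genMap` equal to the quotient map: each monomial in the image goes to
  -- the class of an arbitrary preimage, well defined by `hcongr`. The value `0` elsewhere plays no
  -- role.
  let ρ : MvPolynomial (Arr I Γ) ℂ →ₗ[ℂ] MvPolynomial (Gen I Γ) ℂ ⧸ qideal B :=
    (MvPolynomial.basisMonomials (Arr I Γ) ℂ).constr ℂ
      fun d => if h : ∃ e, monoExp B e = d then q (monomial h.choose 1) else 0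
  have hρ : ρ ∘ₗ (genMap B).toLinearMap = q.toLinearMap := by
    refine (MvPolynomial.basisMonomials (Gen I Γ) ℂ).ext fun e => ?_
    have h : ∃ e', monoExp B e' = monoExp B e := ⟨e, rfl⟩
    have h1 : ρ (monomial (monoExp B e) 1) = q (monomial h.choose 1) := by
      have := (MvPolynomial.basisMonomials (Arr I Γ) ℂ).constr_basis ℂ
        (fun d => if h : ∃ e, monoExp B e = d then q (monomial h.choose 1) else 0) (monoExp B e)
      rw [dif_pos h] at this
      simpa using this
    simp only [coe_basisMonomials, LinearMap.comp_apply, AlgHom.toLinearMap_apply, genMap_monomial,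
      h1]
    exact Ideal.Quotient.eq.2 (hcongr _ _ h.choose_spec)
  have h2 := LinearMap.congr_fun hρ f
  rw [RingHom.mem_ker] at hf
  simp only [LinearMap.comp_apply, AlgHom.toLinearMap_apply, hf, map_zero] at h2
  exact Ideal.Quotient.eq_zero_iff_mem.1 h2.symm

/-- Conservation of flow. -/
def IsBalanced (d : Arr I Γ →₀ ℕ) : Prop :=
  d .c0 + d .a0 = ∑ i, d (.κ i) ∧ ∀ t, d (.a t) + ∑ i with B i t, d (.κ i) = d .a0 + d (.c t)

/-- Greedy filling: each new unit goes to the leftmost column that still has room. -/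
theorem exists_split (K : I → ℕ) (q : ℕ) (hq : q ≤ ∑ i, K i) :
    ∃ y : I → ℕ, ∑ i, y i = q ∧ (∀ i, y i ≤ K i) ∧ ∀ i j, i < j → y i = K i ∨ y j = 0 := by
  induction q with
  | zero => exact ⟨0, by simp, by simp, by simp⟩
  | succ q ih =>
    obtain ⟨y, hy, hyK, hs⟩ := ih (by omega)
    have hne : (Finset.univ.filter fun i => y i < K i).Nonempty := by
      by_contra hcon
      rw [Finset.not_nonempty_iff_eq_empty, Finset.filter_eq_empty_iff] at hcon
      have : ∑ i, K i ≤ ∑ i, y i := Finset.sum_le_sum fun i _ => not_lt.1 (hcon (Finset.mem_univ i))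
      omega
    obtain ⟨i, hi, hmin⟩ := Finset.exists_minimal hne
    simp only [Finset.mem_filter, Finset.mem_univ, true_and] at hi hmin
    refine ⟨y + Pi.single i 1, ?_, fun j => ?_, fun j k hjk => ?_⟩
    · simp [Finset.sum_add_distrib, hy]
    · rcases eq_or_ne j i with rfl | hj
      · simp; omega
      · simp [Pi.single_eq_of_ne hj, hyK j]
    · rcases eq_or_ne k i with rfl | hk
      · left
        have h1 : ¬ y j < K j := fun h => (hmin h hjk.le).not_gt hjk
        have h2 := hyK j
        simp [Pi.single_eq_of_ne hjk.ne]; omega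
      · rcases hs j k hjk with h | h
        · left
          have : j ≠ i := by rintro rfl; omega
          simp [Pi.single_eq_of_ne this, h]
        · right; simp [Pi.single_eq_of_ne hk, h]

include hB in
theorem IsBalanced.exists_monoExp {d : Arr I Γ →₀ ℕ} (hd : IsBalanced B d) :
    ∃ e, monoExp B e = d := by
  obtain ⟨y, hy, hyK, hs⟩ := exists_split (fun i => d (.κ i)) (d .a0) (by have := hd.1; omega)
  have hsplit : ∀ (u : I → ℕ) t, ∑ i, u i = ∑ i with B i t, u i + ∑ i with ¬ B i t, u i :=
    fun u t => (Finset.sum_filter_add_sum_filter_not _ _ _).symm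
  -- If some column beyond the gap received a unit, every column below it is full. The cut equation
  -- then says that `a t` carries all remaining anticlockwise flow plus the flow on `c t`.
  have hle : ∀ t, ∑ i with ¬ B i t, y i ≤ d (.a t) := by
    intro t
    by_cases h0 : ∀ i, ¬ B i t → y i = 0
    · rw [Finset.sum_eq_zero fun i hi => h0 i (Finset.mem_filter.1 hi).2]
      exact Nat.zero_le _
    · push Not at h0
      obtain ⟨j, hj, hyj⟩ := h0
      have h1 : ∑ i with B i t, y i = ∑ i with B i t, d (.κ i) := by
        refine Finset.sum_congr rfl fun i hi => ?_
        have hi := (Finset.mem_filter.1 hi).2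
        have hij : i < j := by
          by_contra hcon
          exact hj (hB j i t (not_lt.1 hcon) hi)
        exact (hs i j hij).resolve_right hyj
      have h2 := hd.2 t
      have h3 := hsplit y t
      omega
  have hK : ∀ t, ∑ i with B i t, d (.κ i) = ∑ i with B i t, (d (.κ i) - y i) +
      ∑ i with B i t, y i := fun t => by
    rw [← Finset.sum_add_distrib]
    exact Finset.sum_congr rfl fun i _ => (tsub_add_cancel_of_le (hyK i)).symm
  let e : Gen I Γ →₀ ℕ := Finsupp.equivFunOnFinite.symm fun g => match g with
    | .top i => d (.κ i) - y i
    | .bot i => y i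
    | .gap t => d (.a t) - ∑ i with ¬ B i t, y i
  have e1 : ∀ i, e (.top i) = d (.κ i) - y i := fun i => rfl
  have e2 : ∀ i, e (.bot i) = y i := fun i => rfl
  have e3 : ∀ t, e (.gap t) = d (.a t) - ∑ i with ¬ B i t, y i := fun t => rfl
  refine ⟨e, ?_⟩
  ext p
  rcases p with _ | _ | i | t | t
  · rw [monoExp_c0]
    simp only [e1]
    have h1 := hd.1
    have h2 : ∑ i, d (.κ i) = ∑ i, (d (.κ i) - y i) + ∑ i, y i := by
      rw [← Finset.sum_add_distrib]
      exact Finset.sum_congr rfl fun i _ => (tsub_add_cancel_of_le (hyK i)).symm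
    omega
  · rw [monoExp_a0]
    simp only [e2, hy]
  · rw [monoExp_κ, e1, e2, tsub_add_cancel_of_le (hyK i)]
  · rw [monoExp_c, e3]
    simp only [e1]
    have h1 := hd.2 t
    have h2 := hK t
    have h3 := hsplit y t
    have h4 := hle t
    omega
  · rw [monoExp_a, e3]
    simp only [e2]
    have h4 := hle t
    omega

end
end Recon

namespace Recon
open MvPolynomial

/-! ## Semi-invariants and balanced exponents -/

section

variable {V : Type} [Quiver.{0} V]

/-- The polynomial `f` is a semi-invariant with the weight of a path from `x` to `y`. -/
def IsPathLike (x y : V) (f : RepRing V) : Prop :=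
  ∀ μ : V → ℂˣ, torusAct μ f = C (((μ x)⁻¹ * μ y : ℂˣ) : ℂ) * f

theorem IsPathLike.mul {x y z : V} {f g : RepRing V} (hf : IsPathLike x y f)
    (hg : IsPathLike y z g) : IsPathLike x z (f * g) := by
  intro μ
  rw [map_mul, hf μ, hg μ]
  have : ((μ x)⁻¹ * μ z : ℂˣ) = ((μ x)⁻¹ * μ y) * ((μ y)⁻¹ * μ z) := by group
  rw [this]
  simp only [Units.val_mul, C_mul]
  ring

theorem IsPathLike.mem_invariantRing {x : V} {f : RepRing V} (hf : IsPathLike x x f) :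
    f ∈ invariantRing V := fun μ => by rw [hf μ]; simp

theorem isPathLike_X (p : Quiver.Total V) : IsPathLike p.left p.right (X p : RepRing V) :=
  fun μ => by simp [torusAct]

variable [Fintype (Quiver.Total V)]

/-- Monomials are eigenvectors of the torus, so invariance can be tested one coefficient at a time.
-/
theorem coeff_torusAct (μ : V → ℂˣ) (d : Quiver.Total V →₀ ℕ) (f : RepRing V) :
    coeff d (torusAct μ f) =
      ((∏ p, ((μ p.left)⁻¹ * μ p.right) ^ d p : ℂˣ) : ℂ) * coeff d f := by
  classical
  induction f using MvPolynomial.induction_on' with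
  | monomial e z =>
    have : torusAct μ (monomial e z) =
        C ((∏ p, ((μ p.left)⁻¹ * μ p.right) ^ e p : ℂˣ) : ℂ) * monomial e z := by
      rw [torusAct, aeval_monomial, monomial_eq, Finsupp.prod_fintype _ _ (by simp),
        Finsupp.prod_fintype _ _ (by simp)]
      simp only [mul_pow, Finset.prod_mul_distrib, algebraMap_eq, Units.coe_prod, map_prod, map_pow, map_mul,
        Units.val_pow_eq_pow_val, Units.val_mul]
      ring
    rw [this, coeff_C_mul, coeff_monomial]
    split_ifs with h
    · rw [h]
    · simp
  | add f g hf hg => rw [map_add, coeff_add, coeff_add, hf, hg, mul_add]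

/-- In the monomials of an invariant polynomial the flow is conserved at each vertex. -/
theorem sum_head_eq_sum_tail [DecidableEq V] {f : RepRing V} (hf : f ∈ invariantRing V)
    {d : Quiver.Total V →₀ ℕ} (hd : d ∈ f.support) (v : V) :
    ∑ p, (if p.right = v then d p else 0) = ∑ p, (if p.left = v then d p else 0) := by
  -- Scaling by `2` at `v` alone suffices: `2` has infinite order, so equal powers give equal in-
  -- and outflow.
  let two : ℂˣ := Units.mk0 2 two_ne_zero
  let μ : V → ℂˣ := fun q => if q = v then two else 1
  have h1 := coeff_torusAct μ d f
  rw [hf μ] at h1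
  have h2 : ∏ p, ((μ p.left)⁻¹ * μ p.right) ^ d p = 1 := by
    rw [← Units.val_inj, Units.val_one]
    exact mul_right_cancel₀ (mem_support_iff.1 hd) (by rw [← h1, one_mul])
  have h3 : ∀ q k, μ q ^ k = two ^ (if q = v then k else 0) := by
    intro q k
    by_cases h : q = v <;> simp [μ, h]
  simp only [mul_pow, inv_pow, h3, Finset.prod_mul_distrib, Finset.prod_inv_distrib,
    Finset.prod_pow_eq_pow_sum] at h2
  rw [inv_mul_eq_one] at h2
  have h4 := congrArg Units.val h2
  simp only [Units.val_pow_eq_pow_val, two, Units.val_mk0] at h4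
  have h5 : 2 ^ (∑ p : Quiver.Total V, if p.left = v then d p else 0) =
      2 ^ (∑ p : Quiver.Total V, if p.right = v then d p else 0) := by exact_mod_cast h4
  exact (Nat.pow_right_injective le_rfl h5).symm

end

/-! ## The arrows of the reconstruction quiver -/

/-- The arrows of the quiver, with and without their end points. -/
def arrowEquiv (α : List ℕ) : Arrow α ≃ Quiver.Total (Vertex α) where
  toFun p := ⟨p.tail, p.head, ⟨p, rfl, rfl⟩⟩
  invFun p := p.hom.1
  left_inv _ := rfl
  right_inv := by rintro ⟨x, y, ⟨p, rfl, rfl⟩⟩; rfl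

theorem arrowVar_eq {α : List ℕ} (p : Arrow α) : arrowVar p = X (arrowEquiv α p) := rfl

/-- The arrows, sorted by kind. -/
def arrowSumEquiv (α : List ℕ) :
    Fin (α.length + 1) ⊕ Fin (α.length + 1) ⊕ Fin (extraTails α).length ≃ Arrow α where
  toFun := Sum.elim .c (Sum.elim .a .k)
  invFun := fun p => match p with
    | .c i => .inl i
    | .a i => .inr (.inl i)
    | .k h => .inr (.inr h)
  left_inv := by rintro (i | i | t) <;> rfl
  right_inv := by rintro (i | i | t) <;> rfl

instance (α : List ℕ) : Fintype (Quiver.Total (Vertex α)) :=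
  .ofEquiv _ ((arrowSumEquiv α).trans (arrowEquiv α))

instance (α : List ℕ) : DecidableEq (Vertex α) := inferInstanceAs (DecidableEq (Fin _))

theorem sum_total {α : List ℕ} (F : Quiver.Total (Vertex α) → ℕ) :
    ∑ p, F p = ∑ i, F (arrowEquiv α (.c i)) + ∑ i, F (arrowEquiv α (.a i)) +
      ∑ h, F (arrowEquiv α (.k h)) := by
  rw [← ((arrowSumEquiv α).trans (arrowEquiv α)).sum_comp, Fintype.sum_sum_type,
    Fintype.sum_sum_type, ← add_assoc]
  rfl

/-- The arrow `k_h`. -/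
def kArrow (α : List ℕ) (h : ℕ) : Arrow α :=
  if h = 0 then .c (Fin.ofNat _ 1)
  else if hk : h - 1 < (extraTails α).length then .k ⟨h - 1, hk⟩
  else .a (Fin.ofNat _ α.length)

theorem kVar_eq (α : List ℕ) (h : ℕ) : kVar α h = arrowVar (kArrow α h) := by
  rw [kVar, kArrow]
  split_ifs <;> rfl

/-- The arrows as arrows of a double path from `1` to `n` with the return arrows `k_h`. -/
def arrOf (α : List ℕ) (m : ℕ) : Arr (Fin (m + 1)) (Fin (α.length - 1)) → Arrow α
  | .c0 => .c (Fin.ofNat _ 0)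
  | .a0 => .a (Fin.ofNat _ 0)
  | .κ i => kArrow α i
  | .c t => .c (Fin.ofNat _ (t + 2))
  | .a t => .a (Fin.ofNat _ (t + 1))

variable {α : List ℕ}

theorem ofNat_inj {n i j : ℕ} (hi : i ≤ n) (hj : j ≤ n) :
    Fin.ofNat (n + 1) i = Fin.ofNat (n + 1) j ↔ i = j := by
  rw [Fin.ext_iff, Fin.val_ofNat, Fin.val_ofNat, Nat.mod_eq_of_lt (by omega),
    Nat.mod_eq_of_lt (by omega)]

theorem exists_ofNat {n : ℕ} (i : Fin (n + 1)) : ∃ j ≤ n, i = Fin.ofNat (n + 1) j :=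
  ⟨i, by omega, by simp⟩

theorem arrOf_bijective (hn : 0 < α.length) {m : ℕ} (hm : m = (extraTails α).length + 1) :
    Function.Bijective (arrOf α m) := by
  constructor
  · rintro (_ | _ | i | t | t) (_ | _ | j | u | u) h <;> simp only [arrOf, kArrow] at h <;>
      (try split_ifs at h) <;> (try simp only [reduceCtorEq, Arrow.c.injEq, Arrow.a.injEq,
        Arrow.k.injEq, Fin.mk.injEq] at h) <;>
      (try rw [ofNat_inj (by omega) (by omega)] at h) <;> (try simp only [Arr.c.injEq, Arr.a.injEq,
        Arr.κ.injEq, Fin.ext_iff]) <;> first | rfl | omega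
  · rintro (i | i | h)
    · obtain ⟨j, hj, rfl⟩ := exists_ofNat i
      rcases j with _ | _ | j
      · exact ⟨.c0, rfl⟩
      · exact ⟨.κ 0, by simp [arrOf, kArrow]⟩
      · exact ⟨.c ⟨j, by omega⟩, rfl⟩
    · obtain ⟨j, hj, rfl⟩ := exists_ofNat i
      rcases j with _ | j
      · exact ⟨.a0, rfl⟩
      · rcases eq_or_ne (j + 1) α.length with h | h
        · exact ⟨.κ (Fin.last m), by simp [arrOf, kArrow, hm, h]⟩
        · exact ⟨.a ⟨j, by omega⟩, rfl⟩
    · exact ⟨.κ ⟨h + 1, by omega⟩, by simp [arrOf, kArrow]⟩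

/-- The equivalence between the arrows of the double path and those of the quiver. -/
noncomputable def arrEquiv (hn : 0 < α.length) {m : ℕ} (hm : m = (extraTails α).length + 1) :
    Arr (Fin (m + 1)) (Fin (α.length - 1)) ≃ Quiver.Total (Vertex α) :=
  (Equiv.ofBijective _ (arrOf_bijective hn hm)).trans (arrowEquiv α)

theorem X_arrEquiv (hn : 0 < α.length) {m : ℕ} (hm : m = (extraTails α).length + 1)
    (p : Arr (Fin (m + 1)) (Fin (α.length - 1))) :
    (X (arrEquiv hn hm p) : RepRing (Vertex α)) = arrowVar (arrOf α m p) := rfl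

/-! ## The tails of the extra arrows -/

theorem mem_extraTails {x : ℕ} (hx : x ∈ extraTails α) : 1 ≤ x ∧ x ≤ α.length := by
  have := mem_tailsFrom (k := 1) x hx
  omega

theorem l_zero : l α 0 = 1 := rfl

theorem l_succ (h : Fin (extraTails α).length) : l α (h + 1) = (extraTails α).get h := by
  rw [l, List.cons_append, List.getD_cons_succ, List.getD_append _ _ _ _ h.2]
  simp

theorem l_last : l α ((extraTails α).length + 1) = α.length := by
  rw [l, List.cons_append, List.getD_cons_succ, List.getD_append_right _ _ _ _ le_rfl]
  simp

theorem l_le (hn : 0 < α.length) {h : ℕ} (hh : h ≤ (extraTails α).length + 1) :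
    1 ≤ l α h ∧ l α h ≤ α.length := by
  rcases h with _ | h
  · rw [l_zero]; omega
  · rcases eq_or_ne h (extraTails α).length with rfl | hne
    · rw [l_last]; omega
    · rw [l_succ ⟨h, by omega⟩]
      exact mem_extraTails (List.get_mem _ _)

theorem l_mono (hn : 0 < α.length) {h h' : ℕ} (hhh : h ≤ h')
    (hh : h' ≤ (extraTails α).length + 1) : l α h ≤ l α h' := by
  rcases eq_or_ne h' ((extraTails α).length + 1) with rfl | hne
  · rw [l_last]; exact (l_le hn (by omega)).2
  rcases h with _ | h
  · rw [l_zero]; exact (l_le hn hh).1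
  obtain ⟨h', rfl⟩ : ∃ k, h' = k + 1 := ⟨h' - 1, by omega⟩
  rw [l_succ ⟨h, by omega⟩, l_succ ⟨h', by omega⟩]
  have := sorted_tailsFrom 1 α
  exact this.sortedLE.monotone_get (Fin.mk_le_mk.2 (Nat.le_of_succ_le_succ hhh))

/-! ## Balanced exponents of the reconstruction quiver -/

/-- The column `i` lies below the gap between the vertices `t + 1` and `t + 2`. -/
abbrev Below (α : List ℕ) (m : ℕ) (i : Fin (m + 1)) (t : Fin (α.length - 1)) : Prop :=
  l α i ≤ t + 1

theorem below_of_le (hn : 0 < α.length) {m : ℕ} (hm : m = (extraTails α).length + 1)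
    (i j : Fin (m + 1)) (t : Fin (α.length - 1)) (hij : i ≤ j) (h : Below α m j t) :
    Below α m i t :=
  (l_mono hn (by exact_mod_cast hij) (by omega)).trans h

theorem ofNat_succ (n i : ℕ) : Fin.ofNat (n + 1) (i + 1) = Fin.ofNat (n + 1) i + 1 := by
  ext; simp [Fin.val_add]

section

variable {f : RepRing (Vertex α)} (hf : f ∈ invariantRing (Vertex α))
  {d : Quiver.Total (Vertex α) →₀ ℕ} (hd : d ∈ f.support)

include hf hd

/-- Conservation at the vertex `u + 1 ≠ 0`, which no extra arrow enters. For `u + 1 = n` the index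
`u + 2` wraps around to `0`. -/
theorem flow_step {u : ℕ} (hu : u < α.length) :
    d (arrowEquiv α (.c (Fin.ofNat _ (u + 2)))) + d (arrowEquiv α (.a (Fin.ofNat _ u))) =
      d (arrowEquiv α (.c (Fin.ofNat _ (u + 1)))) + d (arrowEquiv α (.a (Fin.ofNat _ (u + 1)))) +
      ∑ h, if (extraTails α).get h = u + 1 then d (arrowEquiv α (.k h)) else 0 := by
  have h1 := sum_head_eq_sum_tail hf hd (vtx α (u + 1))
  rw [sum_total, sum_total] at h1
  have e1 : ∀ i : Fin (α.length + 1), (i - 1 = Fin.ofNat (α.length + 1) (u + 1)) ↔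
      i = Fin.ofNat (α.length + 1) (u + 2) := fun i => by
    rw [sub_eq_iff_eq_add, ofNat_succ _ (u + 1)]
  have e2 : ∀ i : Fin (α.length + 1), (i + 1 = Fin.ofNat (α.length + 1) (u + 1)) ↔
      i = Fin.ofNat (α.length + 1) u := fun i => by
    rw [ofNat_succ, add_left_inj]
  have e3 : ¬ Fin.ofNat (α.length + 1) 0 = Fin.ofNat (α.length + 1) (u + 1) := by
    rw [ofNat_inj (by omega) (by omega)]; omega
  have e4 : ∀ h, Fin.ofNat (α.length + 1) ((extraTails α).get h) = Fin.ofNat (α.length + 1) (u + 1) ↔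
      (extraTails α).get h = u + 1 := fun h =>
    ofNat_inj (mem_extraTails (List.get_mem _ _)).2 (by omega)
  change ∑ i : Fin (α.length + 1), (if i - 1 = Fin.ofNat (α.length + 1) (u + 1) then _ else 0) +
    ∑ i : Fin (α.length + 1), (if i + 1 = Fin.ofNat (α.length + 1) (u + 1) then _ else 0) +
    ∑ h, (if Fin.ofNat (α.length + 1) 0 = Fin.ofNat (α.length + 1) (u + 1) then _ else 0) =
    ∑ i : Fin (α.length + 1), (if i = Fin.ofNat (α.length + 1) (u + 1) then _ else 0) +
    ∑ i : Fin (α.length + 1), (if i = Fin.ofNat (α.length + 1) (u + 1) then _ else 0) +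
    ∑ h, (if Fin.ofNat (α.length + 1) ((extraTails α).get h) = Fin.ofNat (α.length + 1) (u + 1)
      then _ else 0) at h1
  simp only [e1, e2, e3, e4, if_false, Finset.sum_const_zero, add_zero, Finset.sum_ite_eq',
    Finset.mem_univ, if_true] at h1
  exact h1

/-- The cut around the vertices `1, …, u`, obtained by telescoping `flow_step`. -/
theorem flow_eq {u : ℕ} (hu : u ≤ α.length) :
    d (arrowEquiv α (.a (Fin.ofNat _ u))) + (d (arrowEquiv α (.c (Fin.ofNat _ 1))) +
      ∑ h, if (extraTails α).get h ≤ u then d (arrowEquiv α (.k h)) else 0) =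
    d (arrowEquiv α (.a (Fin.ofNat _ 0))) + d (arrowEquiv α (.c (Fin.ofNat _ (u + 1)))) := by
  induction u with
  | zero =>
    rw [Finset.sum_eq_zero, add_zero]
    intro h _
    have := (mem_extraTails (List.get_mem (extraTails α) h)).1
    rw [if_neg (by omega)]
  | succ u ih =>
    have h1 := ih (by omega)
    have h2 := flow_step hf hd (u := u) (by omega)
    have h3 : ∑ h, (if (extraTails α).get h ≤ u + 1 then d (arrowEquiv α (.k h)) else 0) =
        ∑ h, (if (extraTails α).get h ≤ u then d (arrowEquiv α (.k h)) else 0) +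
        ∑ h, (if (extraTails α).get h = u + 1 then d (arrowEquiv α (.k h)) else 0) := by
      rw [← Finset.sum_add_distrib]
      refine Finset.sum_congr rfl fun h _ => ?_
      split_ifs <;> omega
    rw [show u + 1 + 1 = u + 2 from rfl]
    omega

theorem isBalanced_of_mem_invariantRing (hn : 0 < α.length) {m : ℕ}
    (hm : m = (extraTails α).length + 1) :
    IsBalanced (Below α m) (d.equivMapDomain (arrEquiv hn hm).symm) := by
  have hv : ∀ p, d.equivMapDomain (arrEquiv hn hm).symm p = d (arrowEquiv α (arrOf α m p)) :=
    fun p => rfl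
  simp only [IsBalanced, hv]
  subst hm
  have hk : ∀ h : Fin (extraTails α).length, kArrow α (h + 1) = .k h := fun h => by simp [kArrow]
  have hlast : kArrow α ((extraTails α).length + 1) = .a (Fin.ofNat _ α.length) := by simp [kArrow]
  have h0 : kArrow α 0 = .c (Fin.ofNat _ 1) := rfl
  constructor
  · have h1 := flow_eq hf hd (u := α.length) le_rfl
    rw [Finset.sum_congr rfl fun h _ => if_pos (mem_extraTails (List.get_mem _ h)).2] at h1
    have h2 : Fin.ofNat (α.length + 1) (α.length + 1) = Fin.ofNat (α.length + 1) 0 := by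
      ext; simp
    rw [h2] at h1
    simp only [arrOf]
    rw [Fin.sum_univ_succ, Fin.sum_univ_castSucc]
    simp only [Fin.val_zero, Fin.val_succ, Fin.val_castSucc, Fin.val_last, hk, hlast, h0]
    omega
  · intro t
    have h1 := flow_eq hf hd (u := t + 1) (by omega)
    simp only [arrOf]
    rw [Finset.sum_filter, Fin.sum_univ_succ, Fin.sum_univ_castSucc]
    simp only [Below, Fin.val_zero, Fin.val_succ, Fin.val_castSucc, Fin.val_last, hk, hlast, h0,
      l_zero, l_succ, l_last]
    -- The column of `k_0` lies below every gap, and the last column, with tail `n`, below none.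
    rw [if_pos (by omega), if_neg (by omega), add_zero]
    exact h1

end

end Recon

namespace Recon
open MvPolynomial

/-! ## The cycles are invariant -/

section

variable (α : List ℕ)

theorem isPathLike_cVar (i : ℕ) : IsPathLike (vtx α (i + 1)) (vtx α i) (cVar α (i + 1)) := by
  have := isPathLike_X (arrowEquiv α (.c (Fin.ofNat _ (i + 1))))
  have h : (arrowEquiv α (.c (Fin.ofNat _ (i + 1)))).right = vtx α i := by
    change Fin.ofNat (α.length + 1) (i + 1) - 1 = Fin.ofNat (α.length + 1) i
    rw [ofNat_succ, add_sub_cancel_right]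
  rw [h] at this
  exact this

theorem isPathLike_aVar (i : ℕ) : IsPathLike (vtx α i) (vtx α (i + 1)) (aVar α i) := by
  have := isPathLike_X (arrowEquiv α (.a (Fin.ofNat _ i)))
  have h : (arrowEquiv α (.a (Fin.ofNat _ i))).right = vtx α (i + 1) :=
    (ofNat_succ _ i).symm
  rw [h] at this
  exact this

theorem vtx_length_succ : vtx α (α.length + 1) = vtx α 0 := by
  change Fin.ofNat (α.length + 1) (α.length + 1) = Fin.ofNat (α.length + 1) 0
  ext; simp

theorem cVar_length_succ : cVar α (α.length + 1) = cVar α 0 := by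
  have : Fin.ofNat (α.length + 1) (α.length + 1) = Fin.ofNat (α.length + 1) 0 := by ext; simp
  rw [cVar, cVar, this]

variable {α}

theorem CPath_eq_mul {i : ℕ} (hi : i < α.length) :
    CPath α i = CPath α (i + 1) * cVar α (i + 1) := by
  rw [CPath, CPath, mul_assoc, ← Finset.insert_Ioc_add_one_left_eq_Ioc hi,
    Finset.prod_insert (by simp), mul_comm (cVar α (i + 1))]

theorem isPathLike_CPath {i : ℕ} (hi : i ≤ α.length) :
    IsPathLike (vtx α 0) (vtx α i) (CPath α i) := by
  induction hi using Nat.decreasingInduction with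
  | self =>
    have := isPathLike_cVar α α.length
    rw [vtx_length_succ, cVar_length_succ] at this
    simpa [CPath] using this
  | of_succ i hi ih =>
    rw [CPath_eq_mul hi]
    exact ih.mul (isPathLike_cVar α i)

theorem isPathLike_prod_aVar (i : ℕ) :
    IsPathLike (vtx α 0) (vtx α i) (∏ j ∈ Finset.range i, aVar α j) := by
  induction i with
  | zero => intro μ; simp
  | succ i ih =>
    rw [Finset.prod_range_succ]
    exact ih.mul (isPathLike_aVar α i)

theorem APath_of_pos {i : ℕ} (hi : 1 ≤ i) : APath α i = ∏ j ∈ Finset.range i, aVar α j := by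
  rw [APath, if_neg (by omega)]

theorem APath_zero_eq_mul (hn : 0 < α.length) : APath α 0 = APath α α.length * aVar α α.length := by
  rw [APath_of_pos hn, APath, if_pos rfl, Finset.prod_range_succ]

theorem kVar_zero : kVar α 0 = cVar α 1 := rfl

theorem kVar_last : kVar α ((extraTails α).length + 1) = aVar α α.length := by
  simp [kVar]

theorem isPathLike_kVar {h : ℕ} (hh : h ≤ (extraTails α).length + 1) :
    IsPathLike (vtx α (l α h)) (vtx α 0) (kVar α h) := by
  rcases h with _ | h
  · exact isPathLike_cVar α 0
  · rcases eq_or_ne h (extraTails α).length with rfl | hne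
    · rw [l_last, kVar_last, ← vtx_length_succ]
      exact isPathLike_aVar α _
    · have hlt : h < (extraTails α).length := by omega
      rw [l_succ ⟨h, hlt⟩]
      have := isPathLike_X (arrowEquiv α (.k ⟨h, hlt⟩))
      have hk : kVar α (h + 1) = X (arrowEquiv α (.k ⟨h, hlt⟩)) := by simp [kVar, hlt, arrowVar_eq]
      rw [hk]
      exact this

/-- The convention `k_0 = c_{1,0}` absorbs the exceptional cycle `C_{00}` into the general pattern.
-/
theorem cycle_top (hn : 0 < α.length) {i : ℕ} (hi : i ≤ (extraTails α).length + 1) :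
    cycle α i 0 = CPath α (l α i) * kVar α i := by
  rcases i with _ | i
  · rw [cycle, if_pos rfl, l_zero, kVar_zero, CPath_eq_mul hn]
  · rw [cycle, if_neg (by omega), if_pos hi, if_pos rfl]

/-- Here the last `k`, equal to `a_{n,0}`, absorbs `A_{00}`. In that final column `cycle` ignores
`j`, hence the conditional hypothesis. -/
theorem cycle_bot (hn : 0 < α.length) {i j : ℕ} (hi : i ≤ (extraTails α).length + 1)
    (hj : i ≠ (extraTails α).length + 1 → j = l α (i + 1) - l α i + 1) :
    cycle α (i + 1) j = APath α (l α i) * kVar α i := by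
  rcases eq_or_ne i ((extraTails α).length + 1) with rfl | hne
  · rw [cycle, if_neg (by omega), if_neg (by omega), l_last, kVar_last, APath_zero_eq_mul hn]
  · have := hj hne
    rw [cycle, if_neg (by omega), if_pos (by omega), if_neg (by omega), if_neg (by simp; omega)]
    simp

theorem cycle_gap {i j t : ℕ} (hi0 : 1 ≤ i) (hi : i ≤ (extraTails α).length + 1) (hj0 : 0 < j)
    (hj : j ≤ l α i - l α (i - 1)) (ht : l α i - j = t) :
    cycle α i j = cVar α (t + 1) * aVar α t := by
  rw [cycle, if_neg (by omega), if_pos hi, if_neg (by omega), if_pos hj, ht,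
    show l α i - (j - 1) = t + 1 by omega]

end

/-! ## The quasimatrix -/

section

variable {α β : List ℕ}

/-- The shape of the quasimatrix fits the extra arrows of the quiver. -/
structure IsDualShape (α β : List ℕ) : Prop where
  pos : 0 < α.length
  length : β.length = (extraTails α).length + 1
  s_eq : ∀ t, 1 ≤ t → t ≤ β.length → s β t = l α t - l α (t - 1) + 1

theorem IsHirzebruchJung.isDualShape {q : ℚ} (hα : IsHirzebruchJung q α)
    (hβ : IsHirzebruchJung (q / (q - 1)) β) : IsDualShape α β := by
  have hd := hα.dual hβ
  have hlen : β.length = (extraTails α).length + 1 := by rw [hd, length_gaps]; simp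
  refine ⟨List.length_pos_of_ne_nil hα.1, hlen, fun t h1 h2 => ?_⟩
  obtain ⟨t, rfl⟩ : ∃ u, t = u + 1 := ⟨t - 1, by omega⟩
  rw [s, if_pos ⟨h1, h2⟩, hd, Nat.add_sub_cancel, getD_gaps _ _ _ (by simp; omega)]
  rfl

namespace IsDualShape

theorem s_zero {β : List ℕ} : s β 0 = 0 := by simp [s]

theorem s_last {β : List ℕ} : s β (β.length + 1) = 0 := by simp [s]

variable (H : IsDualShape α β)
include H

/-- The half-open intervals `[l_{i-1}, l_i)` cover `[1, n)`. The least `i` with `t + 1 < l_i` gives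
the interval containing `t + 1`, and `j = l_i - (t + 1)`. -/
theorem exists_gap (t : Fin (α.length - 1)) : ∃ v : ZIndex β, 0 < (v.2 : ℕ) ∧
    (v.2 : ℕ) < s β v.1 ∧ l α v.1 - v.2 = t + 1 := by
  have hex : ∃ i, t + 1 < l α i := ⟨_, by rw [l_last]; omega⟩
  classical
  have hi := Nat.find_spec hex
  have hmin := fun j => Nat.find_min hex (m := j)
  have hle : Nat.find hex ≤ (extraTails α).length + 1 := Nat.find_min' hex (by rw [l_last]; omega)
  generalize Nat.find hex = i at hi hmin hle
  have h0 : i ≠ 0 := by rintro rfl; rw [l_zero] at hi; omega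
  have h1 := hmin (i - 1) (by omega)
  have hs := H.s_eq i (by omega) (by rw [H.length]; exact hle)
  have hlen := H.length
  have hb : l α i - (t + 1) < s β i := by omega
  exact ⟨⟨⟨i, by omega⟩, ⟨l α i - (t + 1), hb.trans (Nat.lt_succ_self _)⟩⟩,
    by simp; omega, hb, by simp; omega⟩

/-- A middle entry of the quasimatrix lies between the right vertices. -/
theorem gap_bounds {i j : ℕ} (hi : i < β.length + 2) (h0 : 0 < j) (hj : j < s β i) :
    1 ≤ i ∧ i ≤ β.length ∧ j ≤ l α i - l α (i - 1) := by
  have h1 : i ≠ 0 := by rintro rfl; rw [s_zero] at hj; omega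
  have h2 : i ≠ β.length + 1 := by rintro rfl; rw [s_last] at hj; omega
  have := H.s_eq i (by omega) (by omega)
  omega

/-- The same intervals are disjoint because `l` is monotone. -/
theorem gap_unique {v w : ZIndex β} (hv : 0 < (v.2 : ℕ)) (hv' : (v.2 : ℕ) < s β v.1)
    (hw : 0 < (w.2 : ℕ)) (hw' : (w.2 : ℕ) < s β w.1) (h : l α v.1 - v.2 = l α w.1 - w.2) :
    v = w := by
  obtain ⟨i, j⟩ := v
  obtain ⟨i', j'⟩ := w
  simp only at hv hv' hw hw' h
  have h1 := H.gap_bounds i.2 hv hv'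
  have h2 := H.gap_bounds i'.2 hw hw'
  have hlen := H.length
  have hii : i = i' := by
    rcases lt_trichotomy i i' with hlt | heq | hlt
    · have := l_mono H.pos (h := i) (h' := i' - 1) (by omega) (by omega)
      omega
    · exact heq
    · have := l_mono H.pos (h := i') (h' := i - 1) (by omega) (by omega)
      omega
  subst hii
  have : j = j' := by ext; omega
  rw [this]

/-- The variables of the quasimatrix. -/
noncomputable def genOf : Gen (Fin (β.length + 1)) (Fin (α.length - 1)) → ZIndex β
  | .top i => ⟨i.castSucc, 0⟩
  | .bot i => ⟨i.succ, Fin.last _⟩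
  | .gap t => (H.exists_gap t).choose

theorem genOf_bijective : Function.Bijective H.genOf := by
  have hlen := H.length
  -- In an inner block the variables `z_{i,0}` and `z_{i,s_i}` are therefore distinct; the two outer
  -- blocks contribute only a top and only a bottom entry.
  have hs : ∀ i : Fin (β.length + 2), 1 ≤ (i : ℕ) → (i : ℕ) ≤ β.length → 0 < s β i := fun i h1 h2 => by
    rw [H.s_eq i h1 h2]; omega
  have top_ne_bot : ∀ i j, H.genOf (.top i) ≠ H.genOf (.bot j) := by
    intro i j h
    simp only [genOf, Sigma.mk.injEq] at h
    have h1 : (i : ℕ) = j + 1 := by simpa [Fin.ext_iff] using h.1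
    have h2 := congrArg (fun v : ZIndex β => (v.2 : ℕ)) (show H.genOf (.top i) = H.genOf (.bot j) by
      simp only [genOf, Sigma.mk.injEq]; exact h)
    simp only [genOf, Fin.val_zero, Fin.val_last] at h2
    have := hs j.succ (by simp) (by simp; omega)
    omega
  have top_ne_gap : ∀ i t, H.genOf (.top i) ≠ H.genOf (.gap t) := by
    intro i t h
    have h1 := (H.exists_gap t).choose_spec
    change 0 < ((H.genOf (.gap t)).2 : ℕ) ∧ _ at h1
    rw [← h] at h1
    simp [genOf] at h1
  have bot_ne_gap : ∀ i t, H.genOf (.bot i) ≠ H.genOf (.gap t) := by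
    intro i t h
    have h1 := (H.exists_gap t).choose_spec
    change _ ∧ ((H.genOf (.gap t)).2 : ℕ) < s β (H.genOf (.gap t)).1 ∧ _ at h1
    rw [← h] at h1
    simp [genOf] at h1
  constructor
  · rintro (i | i | t) (j | j | u) h
    · simp only [genOf, Sigma.mk.injEq] at h
      rw [Fin.castSucc_injective _ h.1]
    · exact absurd h (top_ne_bot i j)
    · exact absurd h (top_ne_gap i u)
    · exact absurd h.symm (top_ne_bot j i)
    · simp only [genOf, Sigma.mk.injEq] at h
      rw [Fin.succ_injective _ h.1]
    · exact absurd h (bot_ne_gap i u)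
    · exact absurd h.symm (top_ne_gap j t)
    · exact absurd h.symm (bot_ne_gap j t)
    · have h1 := (H.exists_gap t).choose_spec.2.2
      have h2 := (H.exists_gap u).choose_spec.2.2
      change (H.exists_gap t).choose = (H.exists_gap u).choose at h
      rw [h] at h1
      congr 1
      ext; omega
  · rintro ⟨i, j⟩
    by_cases hj : (j : ℕ) = s β i
    · by_cases hi : i = 0
      · subst hi
        exact ⟨.top 0, Sigma.ext rfl (heq_of_eq (Fin.ext (hj.trans s_zero).symm))⟩
      · obtain ⟨i, rfl⟩ := Fin.exists_succ_eq.2 hi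
        exact ⟨.bot i, Sigma.ext rfl (heq_of_eq (Fin.ext hj.symm))⟩
    · have hj' : (j : ℕ) < s β i := by omega
      by_cases hj0 : (j : ℕ) = 0
      · obtain ⟨i, rfl⟩ : ∃ i', i = Fin.castSucc i' := by
          refine ⟨⟨i, ?_⟩, rfl⟩
          have : (i : ℕ) ≠ β.length + 1 := fun h => by
            have : s β i = 0 := by rw [h, s_last]
            omega
          omega
        exact ⟨.top i, Sigma.ext rfl (heq_of_eq (Fin.ext hj0.symm))⟩
      · have h1 := H.gap_bounds i.2 (by omega) hj'
        have h2 := l_le H.pos (h := i) (by omega)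
        have h3 := l_le H.pos (h := i - 1) (by omega)
        have h4 := (H.exists_gap ⟨l α i - j - 1, by omega⟩).choose_spec
        refine ⟨.gap ⟨l α i - j - 1, by omega⟩, ?_⟩
        refine H.gap_unique h4.1 h4.2.1 (by simpa using Nat.pos_of_ne_zero hj0) hj' ?_
        refine h4.2.2.trans ?_
        simp only
        omega

/-- The equivalence between the generators and the variables of the quasimatrix. -/
noncomputable def genEquiv : Gen (Fin (β.length + 1)) (Fin (α.length - 1)) ≃ ZIndex β :=
  Equiv.ofBijective _ H.genOf_bijective

theorem prod_mid (i j : Fin (β.length + 1)) :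
    (∏ t ∈ Finset.univ.filter (fun t : Fin β.length => (i : ℕ) ≤ t ∧ (t : ℕ) < j), (zMatrix β).mid t) =
      ∏ t with Below α _ i t ∧ ¬ Below α _ j t, X (H.genEquiv (.gap t)) := by
  classical
  have hlen := H.length
  -- Both products run over this set: the inner variables of the blocks `i + 1, …, j`.
  let S : Finset (ZIndex β) := Finset.univ.filter fun v =>
    (0 < (v.2 : ℕ) ∧ (v.2 : ℕ) < s β v.1) ∧ (i : ℕ) < v.1 ∧ (v.1 : ℕ) ≤ j
  trans ∏ v ∈ S, (X v : ZRing β)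
  · simp only [zMatrix]
    rw [Finset.prod_sigma']
    refine Finset.prod_bij (fun x _ => ⟨x.1.succ.castSucc, x.2⟩) ?_ ?_ ?_ ?_
    · rintro ⟨t, k⟩ h
      simp only [Finset.mem_sigma, Finset.mem_filter, Finset.mem_univ, true_and] at h
      simp only [S, Finset.mem_filter, Finset.mem_univ, true_and]
      refine ⟨h.2, ?_⟩
      simp
      omega
    · rintro ⟨t, k⟩ _ ⟨t', k'⟩ _ h
      simp only [Sigma.mk.injEq] at h
      obtain rfl := Fin.succ_injective _ (Fin.castSucc_injective _ h.1)
      rw [eq_of_heq h.2]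
    · rintro ⟨i', k⟩ h
      simp only [S, Finset.mem_filter, Finset.mem_univ, true_and] at h
      obtain ⟨t, rfl⟩ : ∃ t : Fin β.length, i' = t.succ.castSucc :=
        ⟨⟨i' - 1, by omega⟩, by ext; simp; omega⟩
      refine ⟨⟨t, k⟩, ?_, rfl⟩
      simp only [Finset.mem_sigma, Finset.mem_filter, Finset.mem_univ, true_and]
      refine ⟨?_, h.1⟩
      have := h.2
      simp at this
      omega
    · rintro ⟨t, k⟩ _
      rfl
  · have hspec : ∀ t, 0 < ((H.genEquiv (.gap t)).2 : ℕ) ∧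
      ((H.genEquiv (.gap t)).2 : ℕ) < s β (H.genEquiv (.gap t)).1 ∧
      l α (H.genEquiv (.gap t)).1 - (H.genEquiv (.gap t)).2 = t + 1 := fun t =>
      (H.exists_gap t).choose_spec
    -- The variable of the gap `t` sits in the block `b` with `l_{b-1} ≤ t + 1 < l_b`, so
    -- monotonicity of `l` turns the condition on tails into one on block numbers.
    have hbelow : ∀ (k : Fin (β.length + 1)) t, Below α _ k t ↔
        (k : ℕ) < (H.genEquiv (.gap t)).1 := by
      intro k t
      obtain ⟨h1, h2, h3⟩ := hspec t
      have h4 := H.gap_bounds (H.genEquiv (.gap t)).1.2 h1 h2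
      constructor
      · intro h
        by_contra hcon
        have := l_mono H.pos (not_lt.1 hcon) (by omega)
        simp only [Below] at h
        omega
      · intro h
        have := l_mono H.pos (Nat.le_sub_one_of_lt h) (by omega)
        simp only [Below]
        omega
    symm
    refine Finset.prod_bij (fun t _ => H.genEquiv (.gap t)) ?_ ?_ ?_ ?_
    · intro t ht
      simp only [Finset.mem_filter, Finset.mem_univ, true_and, hbelow, not_lt] at ht
      simp only [S, Finset.mem_filter, Finset.mem_univ, true_and]
      exact ⟨⟨(hspec t).1, (hspec t).2.1⟩, ht⟩
    · intro t _ t' _ h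
      simpa using h
    · intro v hv
      simp only [S, Finset.mem_filter, Finset.mem_univ, true_and] at hv
      obtain ⟨g, rfl⟩ := H.genEquiv.surjective v
      rcases g with k | k | t
      · simp [genEquiv, genOf] at hv
      · simp [genEquiv, genOf] at hv
      · refine ⟨t, ?_, rfl⟩
        simp only [Finset.mem_filter, Finset.mem_univ, true_and, hbelow, not_lt]
        exact hv.2
    · intros; rfl

theorem rename_qrel (i j : Fin (β.length + 1)) :
    rename H.genEquiv (qrel (Below α β.length) i j) =
      (zMatrix β).top i * (zMatrix β).bot j -
      (zMatrix β).bot i * (∏ t ∈ Finset.univ.filter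
        (fun t : Fin β.length => (i : ℕ) ≤ t ∧ (t : ℕ) < j), (zMatrix β).mid t) *
      (zMatrix β).top j := by
  rw [H.prod_mid]
  simp only [qrel, map_sub, map_mul, map_prod, rename_X]
  rfl

theorem QDet_eq_map : QDet β =
    (qideal (Below α β.length)).map (rename H.genEquiv : _ →ₐ[ℂ] ZRing β) := by
  rw [QDet, qideal, Ideal.map_span]
  congr 1
  ext f
  constructor
  · rintro ⟨i, j, hij, rfl⟩
    exact ⟨_, ⟨i, j, hij, rfl⟩, H.rename_qrel i j⟩
  · rintro ⟨_, ⟨i, j, hij, rfl⟩, rfl⟩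
    exact ⟨i, j, hij, H.rename_qrel i j⟩

end IsDualShape

end

end Recon

/-! ### Kernel and image of the cycle map. -/

namespace Recon
open MvPolynomial

variable {α β : List ℕ}

theorem prod_cVar_below {k : ℕ} (hk : 1 ≤ k) :
    ∏ t ∈ Finset.univ.filter (fun t : Fin (α.length - 1) => k ≤ (t : ℕ) + 1), cVar α (t + 2) =
      ∏ i ∈ Finset.Ioc k α.length, cVar α i := by
  refine Finset.prod_bij (fun t _ => (t : ℕ) + 2) ?_ ?_ ?_ ?_
  · intro t ht
    simp only [Finset.mem_filter, Finset.mem_univ, true_and] at ht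
    simp only [Finset.mem_Ioc]
    omega
  · intro t _ t' _ h
    ext; omega
  · intro i hi
    simp only [Finset.mem_Ioc] at hi
    exact ⟨⟨i - 2, by omega⟩, by simp; omega, by simp; omega⟩
  · intros; rfl

theorem prod_aVar_below {k : ℕ} (hk : 1 ≤ k) (hk' : k ≤ α.length) :
    aVar α 0 * ∏ t ∈ Finset.univ.filter (fun t : Fin (α.length - 1) => ¬ k ≤ (t : ℕ) + 1), aVar α (t + 1) =
      ∏ i ∈ Finset.range k, aVar α i := by
  obtain ⟨k, rfl⟩ : ∃ j, k = j + 1 := ⟨k - 1, by omega⟩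
  rw [Finset.prod_range_succ', mul_comm]
  congr 1
  refine Finset.prod_bij (fun t _ => (t : ℕ)) ?_ ?_ ?_ ?_
  · intro t ht
    simp only [Finset.mem_filter, Finset.mem_univ, true_and] at ht
    simp only [Finset.mem_range]
    omega
  · intro t _ t' _ h
    ext; omega
  · intro i hi
    simp only [Finset.mem_range] at hi
    exact ⟨⟨i, by omega⟩, by simp; omega, rfl⟩
  · intros; rfl

/-- The algebra map sending the variables of the quasimatrix to the cycles of the quiver. -/
noncomputable def cycleMap (α β : List ℕ) : ZRing β →ₐ[ℂ] RepRing (Vertex α) :=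
  aeval fun v => cycle α v.1 v.2

namespace IsDualShape

variable (H : IsDualShape α β)
include H

theorem rename_monomial_genExp (g : Gen (Fin (β.length + 1)) (Fin (α.length - 1))) :
    rename (arrEquiv H.pos H.length) (monomial (genExp (Below α β.length) g) (1 : ℂ)) =
      match g with
      | .top i => CPath α (l α i) * kVar α i
      | .bot i => APath α (l α i) * kVar α i
      | .gap t => cVar α (t + 2) * aVar α (t + 1) := by
  have hX : ∀ p : Arr (Fin (β.length + 1)) (Fin (α.length - 1)), (monomial (Finsupp.single p 1) (1 : ℂ)) = X p := fun _ => rfl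
  have hadd : ∀ u v : Arr (Fin (β.length + 1)) (Fin (α.length - 1)) →₀ ℕ,
      monomial (u + v) (1 : ℂ) = monomial u 1 * monomial v 1 := fun u v => by
    rw [monomial_mul, mul_one]
  have hlen := H.length
  have hl : ∀ i : Fin (β.length + 1), 1 ≤ l α i ∧ l α i ≤ α.length :=
    fun i => l_le H.pos (by omega)
  rcases g with i | i | t
  · simp only [genExp, hadd, monomial_sum_one, hX, map_mul, map_prod, rename_X, X_arrEquiv]
    rw [CPath, ← prod_cVar_below (hl i).1, kVar_eq]
    simp only [arrOf, cVar, Below]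
    ring
  · simp only [genExp, hadd, monomial_sum_one, hX, map_mul, map_prod, rename_X, X_arrEquiv]
    rw [APath_of_pos (hl i).1, ← prod_aVar_below (hl i).1 (hl i).2, kVar_eq]
    simp only [arrOf, aVar, Below]
    ring
  · simp only [genExp, hadd, hX, map_mul, rename_X, X_arrEquiv]
    rfl

theorem cycle_genEquiv (g : Gen (Fin (β.length + 1)) (Fin (α.length - 1))) :
    cycle α (H.genEquiv g).1 (H.genEquiv g).2 =
      rename (arrEquiv H.pos H.length) (monomial (genExp (Below α β.length) g) (1 : ℂ)) := by
  have hlen := H.length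
  rw [H.rename_monomial_genExp]
  rcases g with i | i | t
  · exact cycle_top (i := i) H.pos (by omega)
  · refine cycle_bot H.pos (by omega) fun hi => ?_
    exact H.s_eq (i + 1) (by omega) (by omega)
  · obtain ⟨h1, h2, h3⟩ := (H.exists_gap t).choose_spec
    have h4 := H.gap_bounds (H.exists_gap t).choose.1.2 h1 h2
    exact cycle_gap (i := (H.exists_gap t).choose.1) h4.1 (by omega) h1 h4.2.2 h3

/-- This commuting square transfers the kernel and image of the monomial model to the quiver. -/
theorem cycleMap_rename (f : MvPolynomial (Gen (Fin (β.length + 1)) (Fin (α.length - 1))) ℂ) :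
    cycleMap α β (rename H.genEquiv f) =
      rename (arrEquiv H.pos H.length) (genMap (Below α β.length) f) := by
  have : (cycleMap α β).comp (rename H.genEquiv) =
      (rename (arrEquiv H.pos H.length)).comp (genMap (Below α β.length)) := by
    refine MvPolynomial.algHom_ext fun g => ?_
    simp only [AlgHom.comp_apply, rename_X, cycleMap, genMap, aeval_X]
    exact H.cycle_genEquiv g
  exact DFunLike.congr_fun this f

theorem ker_cycleMap : RingHom.ker (cycleMap α β) = QDet β := by
  rw [H.QDet_eq_map, ← ker_genMap _ (below_of_le H.pos H.length)]
  refine le_antisymm (fun f hf => ?_) (Ideal.map_le_iff_le_comap.2 fun f hf => ?_)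
  · obtain ⟨f, rfl⟩ := (renameEquiv ℂ H.genEquiv).surjective f
    refine Ideal.mem_map_of_mem _ ?_
    rw [RingHom.mem_ker] at hf ⊢
    refine rename_injective _ (arrEquiv H.pos H.length).injective ?_
    rw [← H.cycleMap_rename, map_zero]
    exact hf
  · rw [RingHom.mem_ker] at hf
    rw [Ideal.mem_comap, RingHom.mem_ker]
    erw [H.cycleMap_rename]
    rw [hf, map_zero]

theorem cycle_mem_invariantRing (v : ZIndex β) : cycle α v.1 v.2 ∈ invariantRing (Vertex α) := by
  have hlen := H.length
  obtain ⟨g, rfl⟩ := H.genEquiv.surjective v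
  rw [H.cycle_genEquiv, H.rename_monomial_genExp]
  have hl : ∀ i : Fin (β.length + 1), 1 ≤ l α i ∧ l α i ≤ α.length :=
    fun i => l_le H.pos (by omega)
  rcases g with i | i | t
  · exact ((isPathLike_CPath (hl i).2).mul (isPathLike_kVar (by omega))).mem_invariantRing
  · have h1 := isPathLike_prod_aVar (α := α) (l α i)
    rw [← APath_of_pos (hl i).1] at h1
    exact (h1.mul (isPathLike_kVar (by omega))).mem_invariantRing
  · exact ((isPathLike_cVar α (t + 1)).mul (isPathLike_aVar α (t + 1))).mem_invariantRing

theorem range_cycleMap : (cycleMap α β).range = invariantRing (Vertex α) := by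
  refine le_antisymm ?_ fun f hf => ?_
  · rw [cycleMap, ← Algebra.adjoin_range_eq_range_aeval, Algebra.adjoin_le_iff]
    rintro _ ⟨v, rfl⟩
    exact H.cycle_mem_invariantRing v
  · rw [f.as_sum]
    refine Subalgebra.sum_mem _ fun d hd => ?_
    -- Each monomial of an invariant is balanced, hence itself the image of a monomial.
    obtain ⟨e, he⟩ := (isBalanced_of_mem_invariantRing hf hd H.pos H.length).exists_monoExp _
      (below_of_le H.pos H.length)
    refine ⟨rename H.genEquiv (monomial e (coeff d f)), ?_⟩
    erw [H.cycleMap_rename]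
    rw [genMap_monomial, he, rename_monomial]
    congr 1
    rw [Finsupp.equivMapDomain_eq_mapDomain, ← Finsupp.mapDomain_comp]
    simp

/-- The isomorphism between the quotient by the quasideterminantal relations and the ring of
invariants. -/
noncomputable def invariantEquiv : (ZRing β ⧸ QDet β) ≃ₐ[ℂ] invariantRing (Vertex α) :=
  ((Ideal.quotientEquivAlgOfEq ℂ H.ker_cycleMap.symm).trans
    (Ideal.quotientKerEquivRange (cycleMap α β))).trans
    (Subalgebra.equivOfEq _ _ H.range_cycleMap)

theorem invariantEquiv_mk (f : ZRing β) :
    (H.invariantEquiv (Ideal.Quotient.mk (QDet β) f) : RepRing (Vertex α)) = cycleMap α β f :=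
  rfl

end IsDualShape

end Recon

theorem theorem4 (r a : ℕ) (ha : 0 < a) (har : a < r) (hra : Nat.Coprime r a)
    (α β : List ℕ)
    (hα : Recon.IsHirzebruchJung ((r : ℚ) / (a : ℚ)) α)
    (hβ : Recon.IsHirzebruchJung ((r : ℚ) / ((r : ℚ) - (a : ℚ))) β) :
    ∃ ψ : Recon.invariantRing (Recon.Vertex α) ≃ₐ[ℂ] (Recon.ZRing β ⧸ Recon.QDet β),
      ∀ v : Recon.ZIndex β,
        (ψ.symm (Ideal.Quotient.mk (Recon.QDet β) (MvPolynomial.X v)) :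
          Recon.RepRing (Recon.Vertex α)) = Recon.cycle α v.1 v.2 := by
  have ha' : (a : ℚ) ≠ 0 := by exact_mod_cast ha.ne'
  have har' : (r : ℚ) - a ≠ 0 := sub_ne_zero.2 (by exact_mod_cast har.ne')
  have hq : (r : ℚ) / (r - a) = r / a / (r / a - 1) := by
    rw [div_sub_one ha', div_div_div_cancel_right₀ ha']
  have H := hα.isDualShape (hq ▸ hβ)
  refine ⟨H.invariantEquiv.symm, fun v => ?_⟩
  rw [AlgEquiv.symm_symm, H.invariantEquiv_mk, Recon.cycleMap, MvPolynomial.aeval_X]
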